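/- **Theorem.** Let $(M,g)$ be a connected semi-Riemannian manifold and let $\Sigma$ be a Lie group acting smoothly on $M$ by isometries. Let $I\subset\mathbb{R}$ be an open interval, $\widetilde\varepsilon\in\{1,-1\}$, and let $\pi:(M,g)\to(I,\widetilde\varepsilon\,ds^2)$ be a smooth semi-Riemannian submersion such that for every $s\in I$ the fiber $\pi^{-1}(s)$ is an orbit of $\Sigma$. For $x\in M$ let $H_{\mathrm{fib}}(x)$ be the mean curvature at $x$ of the fiber through $x$ with respect to the normal $\nabla\pi$, that is, $H_{\mathrm{fib}}(x)=\sum_i\varepsilon_i\, g(\nabla_{e_i}\nabla\pi,e_i)$ for an orthonormal basis $(e_i)$ of $\ker d\pi_x$, with $\varepsilon_i=g(e_i,e_i)$ (a trace, not an average). Then $H_{\mathrm{fib}}$ is constant on each orbit, so that there is a function $h:I\to\mathbb{R}$, representing the mean curvature of the orbits, with $H_{\mathrm{fib}}=h\circ\pi$. Let $\varepsilon\in\{1,-1\}$ and equip $M\times\mathbb{R}$ with the metric $g+\varepsilon\,dt^2$. Let $u\in C^2(M,\mathbb{R})$ be such that its graph map $F:M\to M\times\mathbb{R}$, $F(x)=(x,u(x))$,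 is a semi-Riemannian hypersurface (the induced metric $F^*(g+\varepsilon\,dt^2)$ is nondegenerate at every point). Call $F$ a translating soliton if its mean curvature vector $\vec H$ (the trace of its second fundamental form with respect to the induced metric) satisfies $\vec H=\partial_t^{\perp}$, where $\perp$ denotes the normal part along $F$; call it $\Sigma$-invariant if $u(\sigma\cdot x)=u(x)$ for all $\sigma\in\Sigma$, $x\in M$. Then $F$ is a $\Sigma$-invariant translating soliton if and only if there exists $f\in C^2(I,\mathbb{R})$ with $u=f\circ\pi$ and $$f''(s)=\big(\widetilde\varepsilon+\varepsilon f'(s)^2\big)\big(1-f'(s)h(s)\big)\qquad\text{for all } s\in I.$$ -/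

import Mathlib

open scoped Manifold ContDiff

noncomputable section

section Algebra

variable {V W : Type*} [NormedAddCommGroup V] [NormedSpace ℝ V] [FiniteDimensional ℝ V]
  [AddCommGroup W] [Module ℝ W]

/-- The trace `tr_γ B = ∑ᵢⱼ γ^{ij} B(eᵢ, eⱼ)` of a (possibly vector-valued) bilinear map `B` with
respect to a nondegenerate symmetric bilinear form `γ`, where `γ^{ij}` is the inverse of the Gram
matrix of `γ`. Here it is written as `∑ᵢ B(eᵢ, γ⁻¹(eⁱ))`, with `eⁱ` the basis dual to `eᵢ` and
`γ⁻¹ : V* → V` the inverse of `v ↦ γ(v, ·)`. It does not depend on the basis. -/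
def metricTrace (γ : V →L[ℝ] V →L[ℝ] ℝ) (B : V → V → W) : W :=
  ∑ i, B (Module.finBasis ℝ V i)
    (γ.inverse (LinearMap.toContinuousLinearMap ((Module.finBasis ℝ V).coord i)))

end Algebra

section Geometry

variable {E : Type*} [NormedAddCommGroup E] [NormedSpace ℝ E]
  {H : Type*} [TopologicalSpace H] {I : ModelWithCorners ℝ E H}
  {M : Type*} [TopologicalSpace M] [ChartedSpace H M]
  {E' : Type*} [NormedAddCommGroup E'] [NormedSpace ℝ E']
  {H' : Type*} [TopologicalSpace H'] {I' : ModelWithCorners ℝ E' H'}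
  {N : Type*} [TopologicalSpace N] [ChartedSpace H' N]

/-- A field of bilinear forms on the tangent spaces of `M` (a covariant 2-tensor field). -/
abbrev BilinField {E : Type*} [NormedAddCommGroup E] [NormedSpace ℝ E]
    {H : Type*} [TopologicalSpace H] (I : ModelWithCorners ℝ E H)
    (M : Type*) [TopologicalSpace M] [ChartedSpace H M] : Type _ :=
  ∀ x : M, TangentSpace I x →L[ℝ] TangentSpace I x →L[ℝ] ℝ

/-- Nondegeneracy at every point. -/
def BilinField.Nondegenerate (g : BilinField I M) : Prop :=
  ∀ (x : M) (v : TangentSpace I x), (∀ w : TangentSpace I x, g x v w = 0) → v = 0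

/-- `g` is a smooth semi-Riemannian metric. (The index is locally constant, hence constant on a
connected manifold.) -/
structure IsSemiRiemannianMetric [IsManifold I ∞ M] (g : BilinField I M) : Prop where
  symm : ∀ (x : M) (v w : TangentSpace I x), g x v w = g x w v
  nondegenerate : g.Nondegenerate
  contMDiff : ContMDiff I (I.prod 𝓘(ℝ, E →L[ℝ] E →L[ℝ] ℝ)) ∞
    (fun x : M ↦ Bundle.TotalSpace.mk' (E →L[ℝ] E →L[ℝ] ℝ)
      (E := fun x : M ↦ TangentSpace I x →L[ℝ] TangentSpace I x →L[ℝ] ℝ) x (g x))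

/-- The pull-back `F^* g`. -/
def pullbackMetric (g : BilinField I' N) (F : M → N) : BilinField I M := fun x ↦
  let G : E' →L[ℝ] E' →L[ℝ] ℝ := g (F x)
  let A : E →L[ℝ] E' := mfderiv I I' F x
  let B : E →L[ℝ] E →L[ℝ] ℝ := G.bilinearComp A A
  B

/-- `Φ` preserves the metric `g`. -/
def PreservesMetric (g : BilinField I M) (Φ : M → M) : Prop :=
  ∀ x : M, pullbackMetric g Φ x = g x

/-- The metric `c ds²` on the real line. -/
def lineMetric (c : ℝ) : BilinField 𝓘(ℝ, ℝ) ℝ := fun _ ↦ c • ContinuousLinearMap.mul ℝ ℝ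

/-- The product metric `g + ε dt²` on `M × ℝ`. -/
def prodLineMetric (g : BilinField I M) (ε : ℝ) : BilinField (I.prod 𝓘(ℝ, ℝ)) (M × ℝ) := fun p ↦
  pullbackMetric (I := I.prod 𝓘(ℝ, ℝ)) g Prod.fst p +
    pullbackMetric (I := I.prod 𝓘(ℝ, ℝ)) (lineMetric ε) Prod.snd p

variable (I) in
/-- The coordinate vector field `∂_t` on `M × ℝ`. -/
def partialT (p : M × ℝ) : TangentSpace (I.prod 𝓘(ℝ, ℝ)) p :=
  mfderiv 𝓘(ℝ, ℝ) (I.prod 𝓘(ℝ, ℝ)) (fun t : ℝ ↦ (p.1, t)) p.2 (1 : ℝ)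

/-- The coordinate expression of `g` in the preferred chart `φ` at `x`: at `y = φ(p)` it is
`(v, w) ↦ g_p(d(φ⁻¹)_y v, d(φ⁻¹)_y w)`. -/
def localMetric (g : BilinField I M) (x : M) (y : E) : E →L[ℝ] E →L[ℝ] ℝ :=
  pullbackMetric (I := 𝓘(ℝ, E)) g (extChartAt I x).symm y

/-- The Christoffel map `Γ_x(v, w) = Γ^k_{ij} vⁱ wʲ ∂_k` of the metric `g` at `x`, in the preferred
chart at `x`. This is the chart through which Mathlib identifies `T_x M` with the model space `E`.
It is determined by
`g(Γ(v, w), z) = (∂_v g(w, z) + ∂_w g(v, z) - ∂_z g(v, w)) / 2`. -/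
def christoffel (g : BilinField I M) (x : M) (v w : TangentSpace I x) : TangentSpace I x :=
  let D : E →L[ℝ] E →L[ℝ] E →L[ℝ] ℝ := fderiv ℝ (localMetric g x) (extChartAt I x x)
  let G : E →L[ℝ] E →L[ℝ] ℝ := g x
  let v : E := v
  let w : E := w
  G.inverse ((1 / 2 : ℝ) • (D v w + D w v - (D.flip v).flip w))

/-- The Levi-Civita covariant derivative `∇_v X` at `x` of a vector field `X`:
the derivative of the coordinate expression of `X` plus the Christoffel term. -/
def leviCivita (g : BilinField I M) (X : ∀ x : M, TangentSpace I x) (x : M)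
    (v : TangentSpace I x) : TangentSpace I x :=
  let Xloc : E → E := fun y ↦
    mfderiv I 𝓘(ℝ, E) (extChartAt I x) ((extChartAt I x).symm y) (X ((extChartAt I x).symm y))
  let v' : E := v
  let DX : TangentSpace I x := fderiv ℝ Xloc (extChartAt I x x) v'
  DX + christoffel g x v (X x)

/-- The gradient of `f` with respect to `g`: `g(∇f, ·) = df`. -/
def metricGradient (g : BilinField I M) (f : M → ℝ) (x : M) : TangentSpace I x :=
  (g x).inverse (mfderiv I 𝓘(ℝ, ℝ) f x)

/-- `π : (M, g) → (N, g')` has smooth, everywhere surjective differential, its fibers are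
semi-Riemannian submanifolds, and `dπ` preserves the scalar products of horizontal vectors, that is,
of vectors normal to the fibers. -/
structure IsSemiRiemannianSubmersion (g : BilinField I M) (g' : BilinField I' N) (π : M → N) :
    Prop where
  contMDiff : ContMDiff I I' ∞ π
  surjective : ∀ x : M, Function.Surjective (mfderiv I I' π x)
  fiber_nondegenerate : ∀ (x : M) (v : TangentSpace I x), mfderiv I I' π x v = 0 →
    (∀ w : TangentSpace I x, mfderiv I I' π x w = 0 → g x v w = 0) → v = 0
  isometry : ∀ (x : M) (v w : TangentSpace I x),
    (∀ z : TangentSpace I x, mfderiv I I' π x z = 0 → g x v z = 0) →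
    (∀ z : TangentSpace I x, mfderiv I I' π x z = 0 → g x w z = 0) →
    g x v w = g' (π x) (mfderiv I I' π x v) (mfderiv I I' π x w)

/-- The vertical space `ker dπ_x`, tangent to the fiber of `π` through `x`. -/
def verticalSpace (I : ModelWithCorners ℝ E H) (π : M → ℝ) (x : M) : Submodule ℝ E :=
  LinearMap.ker (mfderiv I 𝓘(ℝ, ℝ) π x : E →L[ℝ] ℝ).toLinearMap

/-- The mean curvature (trace, not average) at `x` of the fiber of `π` through `x`, with respect to
the normal `N = ∇π`: `∑ᵢ εᵢ g(∇_{eᵢ} N, eᵢ)` over an orthonormal basis `eᵢ` of the tangent space of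
the fiber, `εᵢ = g(eᵢ, eᵢ)`. -/
def fiberMeanCurvature [FiniteDimensional ℝ E] (g : BilinField I M) (π : M → ℝ) (x : M) : ℝ :=
  let G : E →L[ℝ] E →L[ℝ] ℝ := g x
  let V := verticalSpace I π x
  metricTrace (G.bilinearComp V.subtypeL V.subtypeL)
    (fun v w : V ↦ G (leviCivita g (metricGradient g π) x (v : E)) (w : E))

/-- The function `h` represents the mean curvature of the fibers of `π`: each fiber `π⁻¹(s)` has
constant mean curvature `h s`. -/
def RepresentsFiberMeanCurvature [FiniteDimensional ℝ E] (g : BilinField I M) (π : M → ℝ)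
    (h : ℝ → ℝ) : Prop :=
  ∀ x : M, fiberMeanCurvature g π x = h (π x)

/-- The normal part `ξ^⊥` of `ξ ∈ T_{F(x)} N` along the immersion `F : M → (N, g)` with
nondegenerate induced metric. The tangential part of `ξ` is `dF(a)`, where `a ∈ T_x M` satisfies
`(F^*g)(a, ·) = g(ξ, dF(·))`. -/
def normalPart (I : ModelWithCorners ℝ E H) (g : BilinField I' N) (F : M → N) (x : M)
    (ξ : TangentSpace I' (F x)) : TangentSpace I' (F x) :=
  ξ - mfderiv I I' F x
    ((pullbackMetric (I := I) g F x).inverse ((g (F x) ξ).comp (mfderiv I I' F x)))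

/-- The second fundamental form `II(v, w) = (∇_v dF(w))^⊥` at `x` of the immersion `F : M → (N, g)`.
In charts, if `w` is extended with constant coordinates, `∇_v dF(w)` has the coordinate expression
`D²F(v, w) + Γ(dF v, dF w)`. Another extension of `w` only changes it by a tangential term. -/
def secondFundamentalForm (I : ModelWithCorners ℝ E H) (g : BilinField I' N) (F : M → N) (x : M)
    (v w : TangentSpace I x) : TangentSpace I' (F x) :=
  let v' : E := v
  let w' : E := w
  let D2F : TangentSpace I' (F x) :=
    fderiv ℝ (fderiv ℝ (writtenInExtChartAt I I' x F)) (extChartAt I x x) v' w'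
  normalPart I g F x (D2F + christoffel g (F x) (mfderiv I I' F x v) (mfderiv I I' F x w))

/-- The mean curvature vector `tr_γ II`, with `γ = F^* g`, of the immersion `F : M → (N, g)`. -/
def meanCurvatureVector [FiniteDimensional ℝ E] (I : ModelWithCorners ℝ E H) (g : BilinField I' N)
    (F : M → N) (x : M) : TangentSpace I' (F x) :=
  metricTrace (V := E) (pullbackMetric (I := I) g F x)
    (fun v w : E ↦ secondFundamentalForm I g F x v w)

/-- `F : S → M × ℝ`, of class `C²`, is a translating soliton in `(M × ℝ, g + ε dt²)`: it is an
immersion with nondegenerate induced metric (nondegeneracy forces `dF` to be injective), and its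
mean curvature vector is the normal part of `∂_t`. -/
structure IsTranslatingSoliton {E₀ : Type*} [NormedAddCommGroup E₀] [NormedSpace ℝ E₀]
    [FiniteDimensional ℝ E₀] {H₀ : Type*} [TopologicalSpace H₀] (I₀ : ModelWithCorners ℝ E₀ H₀)
    {S : Type*} [TopologicalSpace S] [ChartedSpace H₀ S]
    (g : BilinField I M) (ε : ℝ) (F : S → M × ℝ) : Prop where
  contMDiff : ContMDiff I₀ (I.prod 𝓘(ℝ, ℝ)) 2 F
  nondegenerate : (pullbackMetric (I := I₀) (prodLineMetric g ε) F).Nondegenerate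
  meanCurvature_eq : ∀ x : S, meanCurvatureVector I₀ (prodLineMetric g ε) F x =
    normalPart I₀ (prodLineMetric g ε) F x (partialT I (F x))

/-- The graph map `x ↦ (x, u x)`. -/
def graphMap {M : Type*} (u : M → ℝ) (x : M) : M × ℝ := (x, u x)

end Geometry

end

noncomputable section

section MetricAlgebra

variable {V W : Type*} [NormedAddCommGroup V] [NormedSpace ℝ V] [FiniteDimensional ℝ V]
  [AddCommGroup W] [Module ℝ W]

theorem isInvertible_of_nondegenerate {γ : V →L[ℝ] V →L[ℝ] ℝ}
    (hγ : ∀ v, (∀ w, γ v w = 0) → v = 0) : γ.IsInvertible := by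
  have hinj : Function.Injective γ.toLinearMap := by
    rw [← LinearMap.ker_eq_bot, LinearMap.ker_eq_bot']
    intro v hv
    refine hγ v fun w ↦ ?_
    have : γ v = 0 := hv
    simp [this]
  have hdim : Module.finrank ℝ V = Module.finrank ℝ (V →L[ℝ] ℝ) := by
    rw [← (LinearMap.toContinuousLinearMap (𝕜 := ℝ) (E := V) (F' := ℝ)).finrank_eq]
    exact (Subspace.dual_finrank_eq (K := ℝ) (V := V)).symm
  refine ⟨(LinearEquiv.ofInjectiveOfFinrankEq γ.toLinearMap hinj hdim).toContinuousLinearEquiv, ?_⟩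
  ext v w
  rfl

theorem apply_inverse_apply {γ : V →L[ℝ] V →L[ℝ] ℝ}
    (hγ : ∀ v, (∀ w, γ v w = 0) → v = 0) (φ : V →L[ℝ] ℝ) : γ (γ.inverse φ) = φ := by
  obtain ⟨e, rfl⟩ := isInvertible_of_nondegenerate hγ
  simp

omit [FiniteDimensional ℝ V] in
theorem eq_of_forall_apply_eq {γ : V →L[ℝ] V →L[ℝ] ℝ}
    (hγ : ∀ v, (∀ w, γ v w = 0) → v = 0) {a b : V} (h : ∀ w, γ a w = γ b w) : a = b :=
  sub_eq_zero.1 (hγ _ fun w ↦ by simp [h w])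

theorem inverse_eq_of_forall_apply_eq {γ : V →L[ℝ] V →L[ℝ] ℝ}
    (hγ : ∀ v, (∀ w, γ v w = 0) → v = 0) {φ : V →L[ℝ] ℝ} {a : V} (h : ∀ w, γ a w = φ w) :
    γ.inverse φ = a :=
  eq_of_forall_apply_eq hγ fun w ↦ by rw [apply_inverse_apply hγ, h]

/-- The metric trace of `B = γ(T ·, ·)` is the trace of the operator `T`. -/
theorem metricTrace_eq_trace {γ : V →L[ℝ] V →L[ℝ] ℝ}
    (hγ : ∀ v, (∀ w, γ v w = 0) → v = 0) (hsymm : ∀ v w, γ v w = γ w v) {B : V → V → ℝ}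
    (T : V →ₗ[ℝ] V) (h : ∀ v w, γ (T v) w = B v w) : metricTrace γ B = LinearMap.trace ℝ V T := by
  rw [LinearMap.trace_eq_matrix_trace ℝ (Module.finBasis ℝ V), Matrix.trace, metricTrace]
  refine Finset.sum_congr rfl fun i _ ↦ ?_
  rw [← h, hsymm, apply_inverse_apply hγ]
  simp [LinearMap.toMatrix_apply]

theorem metricTrace_smul_const (γ : V →L[ℝ] V →L[ℝ] ℝ) (B : V → V → ℝ) (ξ : W) :
    metricTrace γ (fun v w ↦ B v w • ξ) = metricTrace γ B • ξ := by
  simp [metricTrace, Finset.sum_smul]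

end MetricAlgebra

section LocalCalculus

variable {V V' : Type*} [NormedAddCommGroup V] [NormedSpace ℝ V]
  [NormedAddCommGroup V'] [NormedSpace ℝ V']

/-- The first Christoffel symbol `(D_v γ(w, z) + D_w γ(v, z) - D_z γ(v, w)) / 2`, where `D` is the
derivative of `γ`. -/
def christoffelLower (D : V →L[ℝ] V →L[ℝ] V →L[ℝ] ℝ) (v w z : V) : ℝ :=
  1 / 2 * (D v w z + D w v z - D z v w)

/-- Transformation of the derivative of a metric under pull-back. -/
theorem fderiv_pullback_apply {γ : V → V →L[ℝ] V →L[ℝ] ℝ} {γ' : V' → V' →L[ℝ] V' →L[ℝ] ℝ}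
    {φ : V → V'} {y : V} (hγ' : DifferentiableAt ℝ γ' (φ y)) (hγ : DifferentiableAt ℝ γ y)
    (hφ : ContDiffAt ℝ 2 φ y)
    (h : ∀ᶠ z in nhds y, ∀ v w, γ z v w = γ' (φ z) (fderiv ℝ φ z v) (fderiv ℝ φ z w))
    (u v w : V) :
    fderiv ℝ γ y u v w =
      fderiv ℝ γ' (φ y) (fderiv ℝ φ y u) (fderiv ℝ φ y v) (fderiv ℝ φ y w) +
      γ' (φ y) (fderiv ℝ (fderiv ℝ φ) y u v) (fderiv ℝ φ y w) +
      γ' (φ y) (fderiv ℝ φ y v) (fderiv ℝ (fderiv ℝ φ) y u w) := by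
  have hD : HasFDerivAt (fderiv ℝ φ) (fderiv ℝ (fderiv ℝ φ) y) y :=
    ((hφ.fderiv_right (m := 1) (by norm_num)).differentiableAt (by norm_num)).hasFDerivAt
  have hφ' : HasFDerivAt φ (fderiv ℝ φ y) y := (hφ.differentiableAt (by norm_num)).hasFDerivAt
  have h1 := (hγ.hasFDerivAt.clm_apply (hasFDerivAt_const v y)).clm_apply (hasFDerivAt_const w y)
  have hc : HasFDerivAt (fun z ↦ γ' (φ z)) ((fderiv ℝ γ' (φ y)).comp (fderiv ℝ φ y)) y :=
    HasFDerivAt.comp (g := γ') y hγ'.hasFDerivAt hφ'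
  have h2 := (hc.clm_apply
    (hD.clm_apply (hasFDerivAt_const v y))).clm_apply (hD.clm_apply (hasFDerivAt_const w y))
  have h3 := h1.unique (h2.congr_of_eventuallyEq (h.mono fun z hz ↦ hz v w))
  have h4 := DFunLike.congr_fun h3 u
  simp at h4
  rw [h4]
  ring

theorem christoffelLower_pullback {γ : V → V →L[ℝ] V →L[ℝ] ℝ} {γ' : V' → V' →L[ℝ] V' →L[ℝ] ℝ}
    {φ : V → V'} {y : V} (hγ' : DifferentiableAt ℝ γ' (φ y)) (hγ : DifferentiableAt ℝ γ y)
    (hφ : ContDiffAt ℝ 2 φ y) (hsymm : ∀ v w, γ' (φ y) v w = γ' (φ y) w v)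
    (h : ∀ᶠ z in nhds y, ∀ v w, γ z v w = γ' (φ z) (fderiv ℝ φ z v) (fderiv ℝ φ z w))
    (v w z : V) :
    christoffelLower (fderiv ℝ γ y) v w z =
      christoffelLower (fderiv ℝ γ' (φ y)) (fderiv ℝ φ y v) (fderiv ℝ φ y w) (fderiv ℝ φ y z) +
      γ' (φ y) (fderiv ℝ (fderiv ℝ φ) y v w) (fderiv ℝ φ y z) := by
  have hs : IsSymmSndFDerivAt ℝ φ y := hφ.isSymmSndFDerivAt (by simp)
  simp only [christoffelLower, fderiv_pullback_apply hγ' hγ hφ h]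
  rw [hs.eq w v, hs.eq z v, hs.eq z w, hsymm (fderiv ℝ φ y w), hsymm (fderiv ℝ φ y v)]
  ring

/-- Second derivative of a composition. -/
theorem fderiv_fderiv_comp_apply {φ : V → V'} {p : V' → ℝ} {y : V}
    (hφ : ContDiffAt ℝ 2 φ y) (hp : ContDiffAt ℝ 2 p (φ y)) (v w : V) :
    fderiv ℝ (fderiv ℝ (p ∘ φ)) y v w =
      fderiv ℝ (fderiv ℝ p) (φ y) (fderiv ℝ φ y v) (fderiv ℝ φ y w) +
      fderiv ℝ p (φ y) (fderiv ℝ (fderiv ℝ φ) y v w) := by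
  have hφ' : HasFDerivAt φ (fderiv ℝ φ y) y := (hφ.differentiableAt (by norm_num)).hasFDerivAt
  have hD : HasFDerivAt (fderiv ℝ φ) (fderiv ℝ (fderiv ℝ φ) y) y :=
    ((hφ.fderiv_right (m := 1) (by norm_num)).differentiableAt (by norm_num)).hasFDerivAt
  have hDp : HasFDerivAt (fderiv ℝ p) (fderiv ℝ (fderiv ℝ p) (φ y)) (φ y) :=
    ((hp.fderiv_right (m := 1) (by norm_num)).differentiableAt (by norm_num)).hasFDerivAt
  have h1 : ∀ᶠ z in nhds y, fderiv ℝ (p ∘ φ) z = (fderiv ℝ p (φ z)).comp (fderiv ℝ φ z) := by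
    have e1 := hφ.eventually (by simp)
    have e2 := hφ.continuousAt.eventually (hp.eventually (by simp))
    filter_upwards [e1, e2] with z hz1 hz2
    exact fderiv_comp z (hz2.differentiableAt (by norm_num)) (hz1.differentiableAt (by norm_num))
  have h2 := (hDp.comp y hφ').clm_comp hD
  rw [(h2.congr_of_eventuallyEq h1).fderiv]
  simp
  ring

theorem apply_fderiv_of_eventually_eq_fderiv {γ : V → V →L[ℝ] V →L[ℝ] ℝ} {X : V → V} {p : V → ℝ}
    {y : V} (hγ : DifferentiableAt ℝ γ y) (hX : DifferentiableAt ℝ X y) (hp : ContDiffAt ℝ 2 p y)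
    (h : ∀ᶠ z in nhds y, ∀ w, γ z (X z) w = fderiv ℝ p z w) (v w : V) :
    γ y (fderiv ℝ X y v) w = fderiv ℝ (fderiv ℝ p) y v w - fderiv ℝ γ y v (X y) w := by
  have hDp : HasFDerivAt (fderiv ℝ p) (fderiv ℝ (fderiv ℝ p) y) y :=
    ((hp.fderiv_right (m := 1) (by norm_num)).differentiableAt (by norm_num)).hasFDerivAt
  have h1 := (hγ.hasFDerivAt.clm_apply hX.hasFDerivAt).clm_apply (hasFDerivAt_const w y)
  have h2 := hDp.clm_apply (hasFDerivAt_const w y)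
  have h3 := DFunLike.congr_fun
    (h1.unique (h2.congr_of_eventuallyEq (h.mono fun z hz ↦ hz w))) v
  simp at h3
  linarith

theorem fderiv_apply_symm {γ : V → V →L[ℝ] V →L[ℝ] ℝ} {y : V} (hγ : DifferentiableAt ℝ γ y)
    (hsymm : ∀ z v w, γ z v w = γ z w v) (u v w : V) :
    fderiv ℝ γ y u v w = fderiv ℝ γ y u w v := by
  have h (a b : V) :=
    (hγ.hasFDerivAt.clm_apply (hasFDerivAt_const a y)).clm_apply (hasFDerivAt_const b y)
  have h3 := DFunLike.congr_fun
    ((h v w).unique ((h w v).congr_of_eventuallyEq (.of_forall fun z ↦ hsymm z v w))) u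
  simpa using h3

theorem fderiv_fderiv_apply_eq_deriv_deriv {f : ℝ → ℝ} {s : ℝ} (hf : ContDiffAt ℝ 2 f s)
    (a b : ℝ) : fderiv ℝ (fderiv ℝ f) s a b = deriv (deriv f) s * a * b := by
  have hD : HasFDerivAt (fderiv ℝ f) (fderiv ℝ (fderiv ℝ f) s) s :=
    ((hf.fderiv_right (m := 1) (by norm_num)).differentiableAt (by norm_num)).hasFDerivAt
  have h1 := (hD.clm_apply (hasFDerivAt_const 1 s)).hasDerivAt.deriv
  have h2 : deriv (deriv f) s = fderiv ℝ (fderiv ℝ f) s 1 1 := by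
    simpa [fderiv_apply_one_eq_deriv] using h1
  have h3 := (fderiv ℝ (fderiv ℝ f) s).map_smul a 1
  have h4 := (fderiv ℝ (fderiv ℝ f) s 1).map_smul b 1
  simp only [smul_eq_mul, mul_one] at h3 h4
  rw [h2, h3, smul_apply, h4, smul_eq_mul]
  ring

theorem fderiv_apply_self_of_eventually_const {γ : V → V →L[ℝ] V →L[ℝ] ℝ} {X : V → V} {c : ℝ}
    {y : V} (hγ : DifferentiableAt ℝ γ y) (hX : DifferentiableAt ℝ X y)
    (hsymm : ∀ v w, γ y v w = γ y w v) (h : ∀ᶠ z in nhds y, γ z (X z) (X z) = c) (v : V) :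
    fderiv ℝ γ y v (X y) (X y) + 2 * γ y (fderiv ℝ X y v) (X y) = 0 := by
  have h1 := (hγ.hasFDerivAt.clm_apply hX.hasFDerivAt).clm_apply hX.hasFDerivAt
  have h3 := DFunLike.congr_fun
    (h1.unique ((hasFDerivAt_const c y).congr_of_eventuallyEq h)) v
  simp [hsymm (X y)] at h3
  linarith

end LocalCalculus

section Pullback

variable {E : Type*} [NormedAddCommGroup E] [NormedSpace ℝ E]
  {H : Type*} [TopologicalSpace H] {I : ModelWithCorners ℝ E H}
  {M : Type*} [TopologicalSpace M] [ChartedSpace H M]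
  {E' : Type*} [NormedAddCommGroup E'] [NormedSpace ℝ E']
  {H' : Type*} [TopologicalSpace H'] {I' : ModelWithCorners ℝ E' H'}
  {N : Type*} [TopologicalSpace N] [ChartedSpace H' N]
  {E'' : Type*} [NormedAddCommGroup E''] [NormedSpace ℝ E'']
  {H'' : Type*} [TopologicalSpace H''] {I'' : ModelWithCorners ℝ E'' H''}
  {P : Type*} [TopologicalSpace P] [ChartedSpace H'' P]

/-- The value of `g` at `x`, as a bilinear form on the model space `E = T_x M`. -/
abbrev BilinField.form (g : BilinField I M) (x : M) : E →L[ℝ] E →L[ℝ] ℝ := g x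

theorem pullbackMetric_apply (g : BilinField I' N) (F : M → N) (x : M) (v w : TangentSpace I x) :
    pullbackMetric (I := I) g F x v w =
      g (F x) (mfderiv I I' F x v) (mfderiv I I' F x w) := rfl

theorem pullbackMetric_comp (g : BilinField I' N) {F : M → N} {K : P → M} {y : P}
    (hF : MDifferentiableAt I I' F (K y)) (hK : MDifferentiableAt I'' I K y) :
    pullbackMetric (I := I'') g (F ∘ K) y =
      pullbackMetric (I := I'') (pullbackMetric (I := I) g F) K y := by
  ext v w
  simp only [pullbackMetric_apply, mfderiv_comp y hF hK]
  rfl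

theorem pullbackMetric_congr (g : BilinField I' N) {F F' : M → N} {x : M}
    (h : F =ᶠ[nhds x] F') :
    pullbackMetric (I := I) g F x = pullbackMetric (I := I) g F' x := by
  let A : E →L[ℝ] E' := mfderiv I I' F x
  let A' : E →L[ℝ] E' := mfderiv I I' F' x
  have hA : A = A' := h.mfderiv_eq
  change (g.form (F x)).bilinearComp A A = (g.form (F' x)).bilinearComp A' A'
  rw [hA, h.eq_of_nhds]

end Pullback

section Chart

variable {E : Type*} [NormedAddCommGroup E] [NormedSpace ℝ E]
  {H : Type*} [TopologicalSpace H] {I : ModelWithCorners ℝ E H} [I.Boundaryless]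
  {M : Type*} [TopologicalSpace M] [ChartedSpace H M]

theorem eventually_mem_extChartAt_target (x : M) :
    ∀ᶠ y in nhds (extChartAt I x x), y ∈ (extChartAt I x).target :=
  (isOpen_extChartAt_target x).mem_nhds (mem_extChartAt_target x)

variable [IsManifold I ∞ M]

theorem contMDiffAt_extChartAt_symm {x : M} {y : E} (hy : y ∈ (extChartAt I x).target) :
    ContMDiffAt 𝓘(ℝ, E) I ∞ (extChartAt I x).symm y :=
  (contMDiffOn_extChartAt_symm x).contMDiffAt ((isOpen_extChartAt_target x).mem_nhds hy)

theorem mdifferentiableAt_extChartAt_symm {x : M} {y : E} (hy : y ∈ (extChartAt I x).target) :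
    MDifferentiableAt 𝓘(ℝ, E) I (extChartAt I x).symm y :=
  (contMDiffAt_extChartAt_symm hy).mdifferentiableAt (by simp)

theorem mfderiv_extChartAt_symm_self (x : M) :
    mfderiv 𝓘(ℝ, E) I (extChartAt I x).symm (extChartAt I x x) = ContinuousLinearMap.id ℝ E := by
  have : IsManifold I 1 M := IsManifold.of_le (n := ∞) (by simp)
  have := mfderivWithin_range_extChartAt_symm (I := I) (x := x)
  rwa [I.range_eq_univ, mfderivWithin_univ] at this

theorem mfderiv_extChartAt_symm_apply_mfderiv {x : M} {y : E} (hy : y ∈ (extChartAt I x).target)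
    (v : TangentSpace I ((extChartAt I x).symm y)) :
    mfderiv 𝓘(ℝ, E) I (extChartAt I x).symm y
      (mfderiv I 𝓘(ℝ, E) (extChartAt I x) ((extChartAt I x).symm y) v) = v := by
  have : IsManifold I 1 M := IsManifold.of_le (n := ∞) (by simp)
  have := mfderivWithin_extChartAt_symm_comp_mfderiv_extChartAt (I := I) hy
  rw [I.range_eq_univ, mfderivWithin_univ] at this
  exact DFunLike.congr_fun this v

theorem mfderiv_extChartAt_apply_mfderiv_symm {x : M} {y : E} (hy : y ∈ (extChartAt I x).target)
    (v : E) :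
    mfderiv I 𝓘(ℝ, E) (extChartAt I x) ((extChartAt I x).symm y)
      (mfderiv 𝓘(ℝ, E) I (extChartAt I x).symm y v) = v := by
  have : IsManifold I 1 M := IsManifold.of_le (n := ∞) (by simp)
  have := mfderiv_extChartAt_comp_mfderivWithin_extChartAt_symm (I := I) hy
  rw [I.range_eq_univ, mfderivWithin_univ] at this
  exact DFunLike.congr_fun this v

omit [IsManifold I ∞ M] in
theorem mfderiv_eq_fderiv_comp_extChartAt_symm {F : Type*} [NormedAddCommGroup F]
    [NormedSpace ℝ F] {p : M → F} {x : M}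
    (hp : MDifferentiableAt I 𝓘(ℝ, F) p x) :
    mfderiv I 𝓘(ℝ, F) p x = fderiv ℝ (p ∘ (extChartAt I x).symm) (extChartAt I x x) := by
  rw [hp.mfderiv, I.range_eq_univ, fderivWithin_univ]
  rfl

theorem fderiv_comp_extChartAt_symm_apply {F : Type*} [NormedAddCommGroup F]
    [NormedSpace ℝ F] {p : M → F} {x : M} {y : E}
    (hy : y ∈ (extChartAt I x).target)
    (hp : MDifferentiableAt I 𝓘(ℝ, F) p ((extChartAt I x).symm y)) (v : E) :
    fderiv ℝ (p ∘ (extChartAt I x).symm) y v =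
      mfderiv I 𝓘(ℝ, F) p ((extChartAt I x).symm y)
        (mfderiv 𝓘(ℝ, E) I (extChartAt I x).symm y v) := by
  rw [← mfderiv_eq_fderiv, mfderiv_comp y hp (mdifferentiableAt_extChartAt_symm hy)]
  rfl

omit [I.Boundaryless] [IsManifold I ∞ M] in
theorem localMetric_apply (g : BilinField I M) (x : M) (y v w : E) :
    localMetric g x y v w = g ((extChartAt I x).symm y)
      (mfderiv 𝓘(ℝ, E) I (extChartAt I x).symm y v)
      (mfderiv 𝓘(ℝ, E) I (extChartAt I x).symm y w) := rfl

theorem localMetric_self (g : BilinField I M) (x : M) :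
    localMetric g x (extChartAt I x x) = g.form x := by
  let A : E →L[ℝ] E := mfderiv 𝓘(ℝ, E) I (extChartAt I x).symm (extChartAt I x x)
  have hA : A = ContinuousLinearMap.id ℝ E := mfderiv_extChartAt_symm_self x
  change (g.form ((extChartAt I x).symm (extChartAt I x x))).bilinearComp A A = _
  rw [hA, extChartAt_to_inv x]
  rfl

variable {g : BilinField I M}

omit [I.Boundaryless] in
theorem IsSemiRiemannianMetric.localMetric_symm (hg : IsSemiRiemannianMetric g) (x : M)
    (y v w : E) : localMetric g x y v w = localMetric g x y w v := by
  rw [localMetric_apply, localMetric_apply]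
  exact hg.symm _ _ _

theorem IsSemiRiemannianMetric.localMetric_nondegenerate (hg : IsSemiRiemannianMetric g) {x : M}
    {y : E} (hy : y ∈ (extChartAt I x).target) (v : E)
    (hv : ∀ w, localMetric g x y v w = 0) : v = 0 := by
  have h0 : mfderiv 𝓘(ℝ, E) I (extChartAt I x).symm y v = 0 := by
    refine hg.nondegenerate _ _ fun w ↦ ?_
    have := hv (mfderiv I 𝓘(ℝ, E) (extChartAt I x) ((extChartAt I x).symm y) w)
    have := (localMetric_apply g x y _ _).symm.trans this
    rwa [mfderiv_extChartAt_symm_apply_mfderiv hy] at this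
  have h1 := mfderiv_extChartAt_apply_mfderiv_symm hy v
  rw [h0] at h1
  exact h1.symm.trans (map_zero
    (mfderiv I 𝓘(ℝ, E) (extChartAt I x) ((extChartAt I x).symm y)))

theorem IsSemiRiemannianMetric.contDiffOn_localMetric [FiniteDimensional ℝ E]
    (hg : IsSemiRiemannianMetric g) (x : M) :
    ContDiffOn ℝ ∞ (localMetric g x) (extChartAt I x).target := by
  have : IsManifold I 1 M := IsManifold.of_le (n := ∞) (by simp)
  have hsec : ∀ v : E, ContMDiffOn I (I.prod 𝓘(ℝ, E)) ∞
      (fun p : M ↦ Bundle.TotalSpace.mk' E p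
        ((trivializationAt E (TangentSpace I) x).symmL ℝ p v)) (chartAt H x).source := by
    intro v
    refine ContMDiffOn.clm_bundle_apply (E₁ := fun _ : M ↦ E) (F₁ := E) (b := id)
      ((trivializationAt E (TangentSpace I) x).contMDiffOn_symmL (n := ∞) (IB := I))
      (v := fun _ ↦ v) ?_
    intro p hp
    exact Bundle.contMDiffWithinAt_totalSpace.2 ⟨contMDiffWithinAt_id, contMDiffWithinAt_const⟩
  have happ : ∀ v w : E, ContDiffOn ℝ ∞ (fun y ↦ localMetric g x y v w)
      (extChartAt I x).target := by
    intro v w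
    have h1 : ContMDiffOn I 𝓘(ℝ, ℝ) ∞ (fun p : M ↦ g p
        ((trivializationAt E (TangentSpace I) x).symmL ℝ p v)
        ((trivializationAt E (TangentSpace I) x).symmL ℝ p w)) (chartAt H x).source := by
      have := ContMDiffOn.clm_bundle_apply₂ (F₃ := ℝ) (E₃ := fun _ : M ↦ ℝ)
        hg.contMDiff.contMDiffOn (hsec v) (hsec w)
      intro p hp
      have := (Bundle.contMDiffWithinAt_totalSpace.1 (this p hp)).2
      exact this
    have h2 := h1.comp (contMDiffOn_extChartAt_symm x) (fun y hy ↦ by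
      rw [← extChartAt_source I]; exact (extChartAt I x).map_target hy)
    rw [contMDiffOn_iff_contDiffOn] at h2
    refine h2.congr fun y hy ↦ ?_
    have hy' : (extChartAt I x).symm y ∈ (chartAt H x).source := by
      rw [← extChartAt_source I]; exact (extChartAt I x).map_target hy
    simp only [Function.comp_apply]
    rw [localMetric_apply, TangentBundle.symmL_trivializationAt hy', I.range_eq_univ,
      mfderivWithin_univ, (extChartAt I x).right_inv hy]
    rfl
  rw [contDiffOn_clm_apply]
  intro v
  rw [contDiffOn_clm_apply]
  exact fun w ↦ happ v w

theorem IsSemiRiemannianMetric.contDiffAt_localMetric [FiniteDimensional ℝ E]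
    (hg : IsSemiRiemannianMetric g) (x : M) :
    ContDiffAt ℝ ∞ (localMetric g x) (extChartAt I x x) :=
  (hg.contDiffOn_localMetric x).contDiffAt (eventually_mem_extChartAt_target x)

end Chart

section Hessian

variable {E : Type*} [NormedAddCommGroup E] [NormedSpace ℝ E]
  {H : Type*} [TopologicalSpace H] {I : ModelWithCorners ℝ E H}
  {M : Type*} [TopologicalSpace M] [ChartedSpace H M]

/-- The differential of `p` at `x`, as a linear form on the model space `E = T_x M`. -/
abbrev differential (I : ModelWithCorners ℝ E H) (p : M → ℝ) (x : M) : E →L[ℝ] ℝ :=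
  mfderiv I 𝓘(ℝ, ℝ) p x

/-- The Christoffel map, with values in the model space `E = T_x M`. -/
abbrev christoffelVector (g : BilinField I M) (x : M) (v w : E) : E := christoffel g x v w

/-- The gradient of `p` at `x`, in the model space `E = T_x M`. -/
abbrev gradientVector (g : BilinField I M) (p : M → ℝ) (x : M) : E := metricGradient g p x

/-- The covariant derivative `∇_v ∇p` of the gradient, in the model space `E = T_x M`. -/
abbrev covDerivGradient (g : BilinField I M) (p : M → ℝ) (x : M) (v : E) : E :=
  leviCivita g (metricGradient g p) x v

/-- The Hessian `∇dp` of a function `p` at `x`, in the preferred chart at `x`. -/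
def hessian (g : BilinField I M) (p : M → ℝ) (x : M) (v w : E) : ℝ :=
  fderiv ℝ (fderiv ℝ (p ∘ (extChartAt I x).symm)) (extChartAt I x x) v w -
    fderiv ℝ (p ∘ (extChartAt I x).symm) (extChartAt I x x) (christoffelVector g x v w)

variable {g : BilinField I M}

theorem form_christoffel_apply [FiniteDimensional ℝ E] {x : M}
    (hg : ∀ v, (∀ w, g.form x v w = 0) → v = 0)
    (v w z : E) :
    g.form x (christoffelVector g x v w) z =
      christoffelLower (fderiv ℝ (localMetric g x) (extChartAt I x x)) v w z := by
  have := DFunLike.congr_fun (apply_inverse_apply hg ((1 / 2 : ℝ) •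
    (fderiv ℝ (localMetric g x) (extChartAt I x x) v w +
      fderiv ℝ (localMetric g x) (extChartAt I x x) w v -
      ((fderiv ℝ (localMetric g x) (extChartAt I x x)).flip v).flip w))) z
  exact this.trans (by simp [christoffelLower])

variable [I.Boundaryless] [IsManifold I ∞ M] [FiniteDimensional ℝ E]

omit [IsManifold I ∞ M] [FiniteDimensional ℝ E] in
theorem ContMDiffAt.contDiffAt_comp_extChartAt_symm {p : M → ℝ} {x : M}
    (hp : ContMDiffAt I 𝓘(ℝ, ℝ) 2 p x) :
    ContDiffAt ℝ 2 (p ∘ (extChartAt I x).symm) (extChartAt I x x) := by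
  have := (contMDiffAt_iff.1 hp).2
  rwa [I.range_eq_univ, contDiffWithinAt_univ] at this

omit [I.Boundaryless] in
theorem IsSemiRiemannianMetric.form_metricGradient (hg : IsSemiRiemannianMetric g) (p : M → ℝ)
    (x : M) (w : E) : g.form x (gradientVector g p x) w = differential I p x w :=
  DFunLike.congr_fun (apply_inverse_apply (γ := g.form x) (hg.nondegenerate x)
    (mfderiv I 𝓘(ℝ, ℝ) p x : E →L[ℝ] ℝ)) w

omit [I.Boundaryless] [FiniteDimensional ℝ E] in
theorem IsSemiRiemannianMetric.form_nondegenerate (hg : IsSemiRiemannianMetric g) (x : M) (v : E)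
    (hv : ∀ w : E, g.form x v w = 0) : v = 0 :=
  hg.nondegenerate x v hv

omit [I.Boundaryless] [FiniteDimensional ℝ E] in
theorem IsSemiRiemannianMetric.form_symm (hg : IsSemiRiemannianMetric g) (x : M) (v w : E) :
    g.form x v w = g.form x w v :=
  hg.symm x v w

/-- The coordinate expression of a vector field in the preferred chart at `x`. -/
def chartField (X : ∀ x : M, TangentSpace I x) (x : M) (y : E) : E :=
  mfderiv I 𝓘(ℝ, E) (extChartAt I x) ((extChartAt I x).symm y) (X ((extChartAt I x).symm y))

omit [I.Boundaryless] [IsManifold I ∞ M] [FiniteDimensional ℝ E] in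
theorem form_covDerivGradient_eq_add (g : BilinField I M) (p : M → ℝ) (x : M) (v w : E) :
    g.form x (covDerivGradient g p x v) w =
      g.form x (fderiv ℝ (chartField (metricGradient g p) x) (extChartAt I x x) v) w +
        g.form x (christoffelVector g x v (gradientVector g p x)) w :=
  DFunLike.congr_fun (map_add (g.form x) _ _) w

theorem localMetric_chartField_metricGradient (hg : IsSemiRiemannianMetric g) {p : M → ℝ}
    (hp : MDifferentiable I 𝓘(ℝ, ℝ) p) {x : M} {y : E} (hy : y ∈ (extChartAt I x).target) (w : E) :
    localMetric g x y (chartField (metricGradient g p) x y) w =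
      fderiv ℝ (p ∘ (extChartAt I x).symm) y w := by
  rw [localMetric_apply, chartField, mfderiv_extChartAt_symm_apply_mfderiv hy,
    fderiv_comp_extChartAt_symm_apply hy (hp _)]
  exact hg.form_metricGradient p _ _

omit [I.Boundaryless] [FiniteDimensional ℝ E] in
theorem chartField_metricGradient_self (g : BilinField I M) (p : M → ℝ) (x : M) :
    chartField (metricGradient g p) x (extChartAt I x x) = gradientVector g p x := by
  have : IsManifold I 1 M := IsManifold.of_le (n := ∞) (by simp)
  have h : ∀ z, z = x → mfderiv I 𝓘(ℝ, E) (extChartAt I x) z (metricGradient g p z) =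
      gradientVector g p x := by
    rintro z rfl
    rw [mfderiv_extChartAt_self]
    rfl
  exact h _ (extChartAt_to_inv x)

theorem differentiableAt_chartField_metricGradient (hg : IsSemiRiemannianMetric g) {p : M → ℝ}
    (hp : ContMDiff I 𝓘(ℝ, ℝ) 2 p) (x : M) :
    DifferentiableAt ℝ (chartField (metricGradient g p) x) (extChartAt I x x) := by
  have h1 : chartField (metricGradient g p) x =ᶠ[nhds (extChartAt I x x)]
      fun y ↦ (localMetric g x y).inverse (fderiv ℝ (p ∘ (extChartAt I x).symm) y) := by
    filter_upwards [eventually_mem_extChartAt_target x] with y hy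
    exact (inverse_eq_of_forall_apply_eq (hg.localMetric_nondegenerate hy)
      (localMetric_chartField_metricGradient hg (hp.mdifferentiable (by simp)) hy)).symm
  refine DifferentiableAt.congr_of_eventuallyEq ?_ h1
  have h2 := (hp x).contDiffAt_comp_extChartAt_symm
  have h3 := (hg.contDiffAt_localMetric x).differentiableAt (by simp)
  have : FiniteDimensional ℝ (E →L[ℝ] ℝ) := inferInstance
  have h4 : (localMetric g x (extChartAt I x x)).IsInvertible :=
    isInvertible_of_nondegenerate
      (hg.localMetric_nondegenerate (mem_extChartAt_target x))
  have : CompleteSpace E := FiniteDimensional.complete ℝ E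
  exact (((h4.contDiffAt_map_inverse (n := 1)).differentiableAt (by simp)).comp _ h3).clm_apply
    ((h2.fderiv_right (m := 1) (by norm_num)).differentiableAt (by norm_num))

theorem form_covDerivGradient (hg : IsSemiRiemannianMetric g) {p : M → ℝ}
    (hp : ContMDiff I 𝓘(ℝ, ℝ) 2 p) (x : M) (v w : E) :
    g.form x (covDerivGradient g p x v) w = hessian g p x v w := by
  have hX := differentiableAt_chartField_metricGradient hg hp x
  have hG := (hg.contDiffAt_localMetric x).differentiableAt (by simp)
  have h1 := apply_fderiv_of_eventually_eq_fderiv hG hX (hp x).contDiffAt_comp_extChartAt_symm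
    ((eventually_mem_extChartAt_target x).mono fun y hy ↦
      localMetric_chartField_metricGradient hg (hp.mdifferentiable (by simp)) hy) v w
  have h2 : fderiv ℝ (p ∘ (extChartAt I x).symm) (extChartAt I x x) (christoffelVector g x v w) =
      g.form x (christoffelVector g x v w) (gradientVector g p x) := by
    rw [← mfderiv_eq_fderiv_comp_extChartAt_symm (hp.mdifferentiable (by simp) x)]
    exact (hg.form_metricGradient p x _).symm.trans (hg.symm x _ _)
  have h3 := form_covDerivGradient_eq_add g p x v w
  have hs := fderiv_apply_symm hG (hg.localMetric_symm x)
  rw [localMetric_self, chartField_metricGradient_self] at h1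
  rw [hessian, h2, form_christoffel_apply (hg.form_nondegenerate x), h3, h1, form_christoffel_apply (hg.form_nondegenerate x),
    christoffelLower, christoffelLower, hs v w, hs w v]
  ring

theorem form_covDerivGradient_self (hg : IsSemiRiemannianMetric g) {p : M → ℝ}
    (hp : ContMDiff I 𝓘(ℝ, ℝ) 2 p) {c : ℝ}
    (hc : ∀ x, g.form x (gradientVector g p x) (gradientVector g p x) = c) (x : M) (v : E) :
    g.form x (covDerivGradient g p x v) (gradientVector g p x) = 0 := by
  have hX := differentiableAt_chartField_metricGradient hg hp x
  have hG := (hg.contDiffAt_localMetric x).differentiableAt (by simp)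
  have h1 := fderiv_apply_self_of_eventually_const hG hX (hg.localMetric_symm x _) (c := c)
    ((eventually_mem_extChartAt_target x).mono fun y hy ↦ by
      rw [localMetric_apply, chartField, mfderiv_extChartAt_symm_apply_mfderiv hy]
      exact hc _) v
  have h3 := form_covDerivGradient_eq_add g p x v (gradientVector g p x)
  have hs := fderiv_apply_symm hG (hg.localMetric_symm x)
  rw [localMetric_self, chartField_metricGradient_self] at h1
  rw [h3, form_christoffel_apply (hg.form_nondegenerate x),
    christoffelLower, hs _ v]
  linarith

omit [IsManifold I ∞ M] [FiniteDimensional ℝ E] in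
theorem hessian_comp {p : M → ℝ}
    (hp : ContMDiff I 𝓘(ℝ, ℝ) 2 p) {f : ℝ → ℝ} {x : M} (hf : ContDiffAt ℝ 2 f (p x)) (v w : E) :
    hessian g (f ∘ p) x v w =
      deriv (deriv f) (p x) * differential I p x v * differential I p x w +
        deriv f (p x) * hessian g p x v w := by
  have h0 : (p ∘ (extChartAt I x).symm) (extChartAt I x x) = p x := by
    simp
  have h1 := (hp x).contDiffAt_comp_extChartAt_symm
  have h2 := fderiv_fderiv_comp_apply h1 (p := f) (by rwa [h0]) v w
  have h3 : fderiv ℝ (f ∘ p ∘ (extChartAt I x).symm) (extChartAt I x x) =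
      (fderiv ℝ f (p x)).comp (fderiv ℝ (p ∘ (extChartAt I x).symm) (extChartAt I x x)) := by
    rw [fderiv_comp _ (by rw [h0]; exact hf.differentiableAt (by simp))
      (h1.differentiableAt (by simp)), h0]
  rw [h0, fderiv_fderiv_apply_eq_deriv_deriv hf] at h2
  rw [show differential I p x = _ from
    mfderiv_eq_fderiv_comp_extChartAt_symm (hp.mdifferentiable (by simp) x), hessian, hessian,
    Function.comp_assoc, h2, h3]
  rw [ContinuousLinearMap.comp_apply, fderiv_eq_smul_deriv, fderiv_eq_smul_deriv, smul_eq_mul,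
    smul_eq_mul]
  ring

theorem hessian_isometry (hg : IsSemiRiemannianMetric g) {p : M → ℝ}
    (hp : ContMDiff I 𝓘(ℝ, ℝ) 2 p) {Φ : M → M} (hΦ : ContMDiff I I ∞ Φ)
    (hiso : PreservesMetric g Φ) (hpΦ : ∀ x, p (Φ x) = p x) (x : M) (v w : E) :
    hessian g p (Φ x) (mfderiv I I Φ x v) (mfderiv I I Φ x w) = hessian g p x v w := by
  set y₀ := extChartAt I x x with hy₀
  set φ : E → E := writtenInExtChartAt I I x Φ with hφ_def
  have hφy : φ y₀ = extChartAt I (Φ x) (Φ x) := by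
    simp [hφ_def, writtenInExtChartAt, hy₀]
  have hφ : ContDiffAt ℝ 2 φ y₀ := by
    have := (contMDiffAt_iff.1 (hΦ x)).2
    rw [I.range_eq_univ, contDiffWithinAt_univ] at this
    exact this.of_le ENat.LEInfty.out
  have hdφ : (mfderiv I I Φ x : E →L[ℝ] E) = fderiv ℝ φ y₀ := by
    rw [(hΦ.mdifferentiable (by simp) x).mfderiv, I.range_eq_univ, fderivWithin_univ]
  have hev : ∀ᶠ z in nhds y₀, z ∈ (extChartAt I x).target ∧
      φ z ∈ (extChartAt I (Φ x)).target ∧ DifferentiableAt ℝ φ z ∧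
      Φ ∘ (extChartAt I x).symm =ᶠ[nhds z] (extChartAt I (Φ x)).symm ∘ φ := by
    have h1 : ∀ᶠ z in nhds y₀, Φ ((extChartAt I x).symm z) ∈ (extChartAt I (Φ x)).source := by
      have hc : ContinuousAt (Φ ∘ (extChartAt I x).symm) y₀ :=
        hΦ.continuous.continuousAt.comp (continuousAt_extChartAt_symm x)
      refine hc.eventually ((isOpen_extChartAt_source (I := I) (Φ x)).mem_nhds ?_)
      simp [y₀]
    filter_upwards [eventually_mem_extChartAt_target (I := I) x, h1,
      hφ.eventually (by decide), h1.eventually_nhds] with z hz hz1 hz2 hz3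
    refine ⟨hz, (extChartAt I (Φ x)).map_source hz1, hz2.differentiableAt (by norm_num), ?_⟩
    filter_upwards [hz3] with z' hz'
    exact ((extChartAt I (Φ x)).left_inv hz').symm
  have hloc : ∀ᶠ z in nhds y₀, ∀ v w, localMetric g x z v w =
      localMetric g (Φ x) (φ z) (fderiv ℝ φ z v) (fderiv ℝ φ z w) := by
    filter_upwards [hev] with z ⟨hz, hz1, hz2, hz3⟩ v w
    have s1 : localMetric g x z = pullbackMetric (I := 𝓘(ℝ, E)) (pullbackMetric (I := I) g Φ)
        (extChartAt I x).symm z := by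
      rw [show pullbackMetric (I := I) g Φ = g from funext hiso]
      rfl
    have s2 := pullbackMetric_comp (I := I) (I'' := 𝓘(ℝ, E)) g
      (hΦ.mdifferentiable (by simp) _) (mdifferentiableAt_extChartAt_symm hz)
    have s3 := pullbackMetric_congr (I := 𝓘(ℝ, E)) g hz3
    have s4 := pullbackMetric_comp (I := 𝓘(ℝ, E)) (I'' := 𝓘(ℝ, E)) g
      (mdifferentiableAt_extChartAt_symm hz1) hz2.mdifferentiableAt
    have e1 : localMetric g x z =
        pullbackMetric (I := 𝓘(ℝ, E)) (I' := 𝓘(ℝ, E)) (localMetric g (Φ x)) φ z :=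
      s1.trans (s2.symm.trans (s3.trans s4))
    rw [e1, ← mfderiv_eq_fderiv]
    rfl
  have hp' : ContDiffAt ℝ 2 (p ∘ (extChartAt I (Φ x)).symm) (φ y₀) := by
    rw [hφy]; exact (hp (Φ x)).contDiffAt_comp_extChartAt_symm
  have hpφ : p ∘ (extChartAt I x).symm =ᶠ[nhds y₀] (p ∘ (extChartAt I (Φ x)).symm) ∘ φ := by
    filter_upwards [hev.self_of_nhds.2.2.2] with z hz
    simp only [Function.comp_apply] at hz ⊢
    rw [← hz, hpΦ]
  have hG : DifferentiableAt ℝ (localMetric g x) y₀ :=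
    (hg.contDiffAt_localMetric x).differentiableAt (by simp)
  have hG' : DifferentiableAt ℝ (localMetric g (Φ x)) (φ y₀) := by
    rw [hφy]; exact (hg.contDiffAt_localMetric (Φ x)).differentiableAt (by simp)
  have hsymm := hg.localMetric_symm (Φ x) (φ y₀)
  have hself : localMetric g (Φ x) (φ y₀) = g.form (Φ x) := by rw [hφy, localMetric_self]
  have hform : ∀ a b, g.form x a b = g.form (Φ x) (fderiv ℝ φ y₀ a) (fderiv ℝ φ y₀ b) := by
    intro a b
    have := hloc.self_of_nhds a b
    rwa [hself, localMetric_self] at this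
  have hinj : Function.Injective (fderiv ℝ φ y₀).toLinearMap := by
    rw [← LinearMap.ker_eq_bot, LinearMap.ker_eq_bot']
    intro a ha
    refine hg.form_nondegenerate x a fun b ↦ ?_
    have ha' : fderiv ℝ φ y₀ a = 0 := ha
    have := hform a b
    rwa [ha', map_zero] at this
  have hsurj := LinearMap.injective_iff_surjective.1 hinj
  have hΓ : fderiv ℝ φ y₀ (christoffelVector g x v w) =
      fderiv ℝ (fderiv ℝ φ) y₀ v w +
        christoffelVector g (Φ x) (fderiv ℝ φ y₀ v) (fderiv ℝ φ y₀ w) := by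
    refine eq_of_forall_apply_eq (γ := g.form (Φ x)) (hg.form_nondegenerate (Φ x)) fun b ↦ ?_
    obtain ⟨c, rfl⟩ := hsurj b
    have h1 := form_christoffel_apply (hg.form_nondegenerate x) v w c
    rw [← hy₀, christoffelLower_pullback hG' hG hφ hsymm hloc, hform, hself] at h1
    have h2 := form_christoffel_apply (hg.form_nondegenerate (Φ x)) (fderiv ℝ φ y₀ v)
      (fderiv ℝ φ y₀ w) (fderiv ℝ φ y₀ c)
    rw [← hφy] at h2
    rw [map_add, add_apply, add_comm]
    exact h1.trans (congrArg (· + _) h2.symm)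
  have hD1 : fderiv ℝ (p ∘ (extChartAt I x).symm) y₀ =
      (fderiv ℝ (p ∘ (extChartAt I (Φ x)).symm) (φ y₀)).comp (fderiv ℝ φ y₀) := by
    rw [hpφ.fderiv_eq]
    exact fderiv_comp _ (hp'.differentiableAt (by simp)) (hφ.differentiableAt (by simp))
  have hD2 := fderiv_fderiv_comp_apply hφ hp' v w
  rw [← hpφ.fderiv.fderiv_eq] at hD2
  change hessian g p (Φ x) ((mfderiv I I Φ x : E →L[ℝ] E) v) ((mfderiv I I Φ x : E →L[ℝ] E) w) = _
  rw [hdφ]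
  unfold hessian
  rw [← hφy, ← hy₀, hD1, hD2, ContinuousLinearMap.comp_apply, hΓ, map_add]
  have key : ∀ a b c : ℝ, a - c = a + b - (b + c) := fun a b c ↦ by ring
  exact key _ _ _

end Hessian

section Submersion

variable {E : Type*} [NormedAddCommGroup E] [NormedSpace ℝ E] [FiniteDimensional ℝ E]
  {H : Type*} [TopologicalSpace H] {I : ModelWithCorners ℝ E H} [I.Boundaryless]
  {M : Type*} [TopologicalSpace M] [ChartedSpace H M] [IsManifold I ∞ M]
  {g : BilinField I M}

omit [I.Boundaryless] in
theorem form_covDerivGradient_eq_add_christoffelLower (hg : IsSemiRiemannianMetric g) (p : M → ℝ)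
    (x : M) (v w : E) :
    g.form x (covDerivGradient g p x v) w =
      g.form x (fderiv ℝ (chartField (metricGradient g p) x) (extChartAt I x x) v) w +
        christoffelLower (fderiv ℝ (localMetric g x) (extChartAt I x x)) v
          (gradientVector g p x) w := by
  rw [form_covDerivGradient_eq_add, form_christoffel_apply (hg.form_nondegenerate x)]

/-- The operator `v ↦ ∇_v ∇p` on `T_x M`. -/
def hessianOperator (hg : IsSemiRiemannianMetric g) (p : M → ℝ) (x : M) : E →ₗ[ℝ] E where
  toFun := covDerivGradient g p x
  map_add' v w := by
    refine eq_of_forall_apply_eq (hg.form_nondegenerate x) fun z ↦ ?_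
    simp only [map_add, add_apply, form_covDerivGradient_eq_add_christoffelLower hg,
      christoffelLower]
    ring
  map_smul' c v := by
    refine eq_of_forall_apply_eq (hg.form_nondegenerate x) fun z ↦ ?_
    simp only [map_smul, smul_apply, form_covDerivGradient_eq_add_christoffelLower hg,
      christoffelLower, smul_eq_mul, RingHom.id_apply]
    ring

theorem form_hessianOperator (hg : IsSemiRiemannianMetric g) {p : M → ℝ}
    (hp : ContMDiff I 𝓘(ℝ, ℝ) 2 p) (x : M) (v w : E) :
    g.form x (hessianOperator hg p x v) w = hessian g p x v w :=
  form_covDerivGradient hg hp x v w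

theorem trace_hessianOperator_isometry (hg : IsSemiRiemannianMetric g) {p : M → ℝ}
    (hp : ContMDiff I 𝓘(ℝ, ℝ) 2 p) {Φ : M → M} (hΦ : ContMDiff I I ∞ Φ)
    (hiso : PreservesMetric g Φ) (hpΦ : ∀ x, p (Φ x) = p x) (x : M) :
    LinearMap.trace ℝ E (hessianOperator hg p (Φ x)) =
      LinearMap.trace ℝ E (hessianOperator hg p x) := by
  let A : E →L[ℝ] E := mfderiv I I Φ x
  have hA : ∀ a b, g.form (Φ x) (A a) (A b) = g.form x a b := fun a b ↦
    DFunLike.congr_fun (DFunLike.congr_fun (hiso x) a) b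
  have hinj : Function.Injective A.toLinearMap := by
    rw [← LinearMap.ker_eq_bot, LinearMap.ker_eq_bot']
    intro a ha
    refine hg.form_nondegenerate x a fun b ↦ ?_
    have ha' : A a = 0 := ha
    rw [← hA, ha', map_zero]
    rfl
  let e : E ≃ₗ[ℝ] E := LinearEquiv.ofInjectiveEndo A.toLinearMap hinj
  have he : ∀ v, e v = A v := fun v ↦ rfl
  have hconj : hessianOperator hg p (Φ x) = e.conj (hessianOperator hg p x) := by
    ext b
    obtain ⟨v, rfl⟩ := e.surjective b
    rw [LinearEquiv.conj_apply_apply, LinearEquiv.symm_apply_apply]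
    refine eq_of_forall_apply_eq (hg.form_nondegenerate (Φ x)) fun c ↦ ?_
    obtain ⟨w, rfl⟩ := e.surjective c
    rw [form_hessianOperator hg hp, he, he, he, hA, form_hessianOperator hg hp]
    exact hessian_isometry hg hp hΦ hiso hpΦ x v w
  rw [hconj, LinearMap.trace_conj']

variable {π : M → ℝ} {c : ℝ}

omit [FiniteDimensional ℝ E] [I.Boundaryless] [IsManifold I ∞ M] in
theorem IsSemiRiemannianSubmersion.differential_ne_zero
    (hπ : IsSemiRiemannianSubmersion g (lineMetric c) π) (x : M) : differential I π x ≠ 0 := by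
  intro h
  obtain ⟨v, hv⟩ := hπ.surjective x (1 : ℝ)
  have : differential I π x v = 1 := hv
  rw [h] at this
  exact zero_ne_one this

omit [I.Boundaryless] in
theorem IsSemiRiemannianSubmersion.differential_gradientVector
    (hg : IsSemiRiemannianMetric g) (hc : c * c = 1)
    (hπ : IsSemiRiemannianSubmersion g (lineMetric c) π) (x : M) :
    differential I π x (gradientVector g π x) = c := by
  set N := gradientVector g π x
  set d := differential I π x
  have hN : ∀ w, g.form x N w = d w := hg.form_metricGradient π x
  have h1 : g.form x N N = c * (d N * d N) := by
    have hhor : ∀ z : TangentSpace I x, mfderiv I 𝓘(ℝ, ℝ) π x z = 0 → g x N z = 0 := fun z hz ↦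
      (hN z).trans hz
    exact hπ.isometry x N N hhor hhor
  have h2 : d N ≠ 0 := by
    intro h0
    have hN0 : N = 0 := hπ.fiber_nondegenerate x N h0 fun w hw ↦ (hN w).trans hw
    refine hπ.differential_ne_zero x ?_
    ext w
    change d w = 0
    rw [← hN, hN0, map_zero]
    rfl
  rw [hN] at h1
  have h3 : c * d N = 1 := by
    have : d N * (c * d N - 1) = 0 := by linear_combination -h1
    rcases mul_eq_zero.1 this with h | h
    · exact absurd h h2
    · linarith
  linear_combination c * h3 - d N * hc

theorem IsSemiRiemannianSubmersion.differential_hessianOperator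
    (hg : IsSemiRiemannianMetric g) (hc : c * c = 1)
    (hπ : IsSemiRiemannianSubmersion g (lineMetric c) π) (x : M) (v : E) :
    differential I π x (hessianOperator hg π x v) = 0 := by
  rw [← hg.form_metricGradient π x]
  exact (hg.form_symm x _ _).trans (form_covDerivGradient_self hg
    (hπ.contMDiff.of_le ENat.LEInfty.out) (c := c) (fun y ↦ (hg.form_metricGradient π y _).trans
      (hπ.differential_gradientVector hg hc y)) x v)

/-- The mean curvature of the fibers with respect to `∇π` is the trace of the Hessian of `π`. -/
theorem IsSemiRiemannianSubmersion.fiberMeanCurvature_eq_trace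
    (hg : IsSemiRiemannianMetric g) (hc : c * c = 1)
    (hπ : IsSemiRiemannianSubmersion g (lineMetric c) π) (x : M) :
    fiberMeanCurvature g π x = LinearMap.trace ℝ E (hessianOperator hg π x) := by
  have hmem : ∀ v, hessianOperator hg π x v ∈ verticalSpace I π x := fun v ↦
    hπ.differential_hessianOperator hg hc x v
  rw [← LinearMap.trace_restrict_eq_of_forall_mem (verticalSpace I π x) _ hmem]
  let V := verticalSpace I π x
  refine metricTrace_eq_trace (V := V) (γ := (g.form x).bilinearComp V.subtypeL V.subtypeL)
    (B := fun v w : V ↦ g.form x (covDerivGradient g π x v) w) ?_ ?_ _ ?_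
  · intro v hv
    exact Subtype.ext (hπ.fiber_nondegenerate x v.1 v.2 fun w hw ↦ hv ⟨w, hw⟩)
  · exact fun v w ↦ hg.form_symm x v w
  · exact fun v w ↦ rfl

end Submersion

section NormalPart

variable {V V' : Type*} [NormedAddCommGroup V] [NormedSpace ℝ V] [FiniteDimensional ℝ V]
  [NormedAddCommGroup V'] [NormedSpace ℝ V']

/-- The component of `ξ` orthogonal to the range of `A`. -/
def normalComponent (γ : V' →L[ℝ] V' →L[ℝ] ℝ) (A : V →L[ℝ] V') (ξ : V') : V' :=
  ξ - A ((γ.bilinearComp A A).inverse ((γ ξ).comp A))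

theorem normalComponent_add_smul {γ : V' →L[ℝ] V' →L[ℝ] ℝ} {A : V →L[ℝ] V'}
    (hγ : ∀ v, (∀ w, γ.bilinearComp A A v w = 0) → v = 0) (a : V) (c : ℝ) (ξ : V') :
    normalComponent γ A (A a + c • ξ) = c • normalComponent γ A ξ := by
  have h : (γ.bilinearComp A A).inverse ((γ (A a + c • ξ)).comp A) =
      a + c • (γ.bilinearComp A A).inverse ((γ ξ).comp A) := by
    refine inverse_eq_of_forall_apply_eq hγ fun w ↦ ?_
    rw [map_add, map_smul, apply_inverse_apply hγ]
    simp
  rw [normalComponent, h, normalComponent, map_add, map_smul]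
  module

omit [FiniteDimensional ℝ V] in
theorem normalComponent_eq_zero {γ : V' →L[ℝ] V' →L[ℝ] ℝ} {A : V →L[ℝ] V'} {ξ : V'}
    (h : normalComponent γ A ξ = 0) : ∃ a, A a = ξ :=
  ⟨_, (sub_eq_zero.1 h).symm⟩

end NormalPart

section Product

variable {E : Type*} [NormedAddCommGroup E] [NormedSpace ℝ E]
  {H : Type*} [TopologicalSpace H] {I : ModelWithCorners ℝ E H}
  {M : Type*} [TopologicalSpace M] [ChartedSpace H M]
  {g : BilinField I M}

theorem prodLineMetric_form_apply (g : BilinField I M) (ε : ℝ) (p : M × ℝ) (v w : E × ℝ) :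
    (prodLineMetric g ε).form p v w = g.form p.1 v.1 w.1 + ε * (v.2 * w.2) := by
  let A : E × ℝ →L[ℝ] E := mfderiv (I.prod 𝓘(ℝ, ℝ)) I (Prod.fst : M × ℝ → M) p
  let B : E × ℝ →L[ℝ] ℝ := mfderiv (I.prod 𝓘(ℝ, ℝ)) 𝓘(ℝ, ℝ) (Prod.snd : M × ℝ → ℝ) p
  have hA : A = ContinuousLinearMap.fst ℝ E ℝ := mfderiv_fst
  have hB : B = ContinuousLinearMap.snd ℝ E ℝ := mfderiv_snd
  change g.form p.1 (A v) (A w) + ε * (B v * B w) = _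
  rw [hA, hB]
  rfl

theorem prodLineMetric_form_nondegenerate {ε : ℝ} (hε : ε ≠ 0) {p : M × ℝ}
    (hg : ∀ v, (∀ w, g.form p.1 v w = 0) → v = 0) (v : E × ℝ)
    (hv : ∀ w, (prodLineMetric g ε).form p v w = 0) : v = 0 := by
  simp only [prodLineMetric_form_apply] at hv
  refine Prod.ext (hg v.1 fun w ↦ by simpa using hv (w, 0)) ?_
  simpa [hε] using hv (0, 1)

variable [I.Boundaryless] [IsManifold I ∞ M]

theorem localMetric_prodLineMetric (g : BilinField I M) (ε : ℝ) (p : M × ℝ) {z : E × ℝ}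
    (hz : z.1 ∈ (extChartAt I p.1).target) (v w : E × ℝ) :
    localMetric (prodLineMetric g ε) p z v w = localMetric g p.1 z.1 v.1 w.1 + ε * (v.2 * w.2) := by
  have hd := mdifferentiableAt_extChartAt_symm hz
  have hm : HasMFDerivAt 𝓘(ℝ, E × ℝ) (I.prod 𝓘(ℝ, ℝ))
      (fun z : E × ℝ ↦ ((extChartAt I p.1).symm z.1, z.2)) z
      ((mfderiv 𝓘(ℝ, E) I (extChartAt I p.1).symm z.1 ∘L ContinuousLinearMap.fst ℝ E ℝ).prod
        (ContinuousLinearMap.snd ℝ E ℝ)) :=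
    (HasMFDerivAt.comp (I' := 𝓘(ℝ, E)) z hd.hasMFDerivAt
      (hasFDerivAt_fst (𝕜 := ℝ) (p := z)).hasMFDerivAt).prodMk
      (hasFDerivAt_snd (𝕜 := ℝ) (p := z)).hasMFDerivAt
  have hs : ((extChartAt (I.prod 𝓘(ℝ, ℝ)) p).symm : E × ℝ → M × ℝ) =
      fun z : E × ℝ ↦ ((extChartAt I p.1).symm z.1, z.2) := by
    rw [extChartAt_prod]
    rfl
  let A : E × ℝ →L[ℝ] E × ℝ :=
    mfderiv 𝓘(ℝ, E × ℝ) (I.prod 𝓘(ℝ, ℝ)) (fun z : E × ℝ ↦ ((extChartAt I p.1).symm z.1, z.2)) z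
  have hA : ∀ v, A v = ((mfderiv 𝓘(ℝ, E) I (extChartAt I p.1).symm z.1 v.1 : E), v.2) := fun v ↦
    DFunLike.congr_fun hm.mfderiv v
  change pullbackMetric (I := 𝓘(ℝ, E × ℝ)) (prodLineMetric g ε)
    (extChartAt (I.prod 𝓘(ℝ, ℝ)) p).symm z v w = _
  rw [hs]
  refine (prodLineMetric_form_apply g ε ((extChartAt I p.1).symm z.1, z.2) (A v) (A w)).trans ?_
  rw [hA, hA]
  rfl

variable [FiniteDimensional ℝ E]

theorem christoffelLower_prodLineMetric (hg : IsSemiRiemannianMetric g) (ε : ℝ) (p : M × ℝ)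
    (u v w : E × ℝ) :
    christoffelLower (fderiv ℝ (localMetric (prodLineMetric g ε) p)
      (extChartAt (I.prod 𝓘(ℝ, ℝ)) p p)) u v w =
    christoffelLower (fderiv ℝ (localMetric g p.1) (extChartAt I p.1 p.1)) u.1 v.1 w.1 := by
  set z₀ : E × ℝ := extChartAt (I.prod 𝓘(ℝ, ℝ)) p p
  have hz₀ : z₀.1 = extChartAt I p.1 p.1 := by simp [z₀]
  have hopen : IsOpen (Prod.fst ⁻¹' (extChartAt I p.1).target : Set (E × ℝ)) :=
    (isOpen_extChartAt_target p.1).preimage continuous_fst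
  have hmem : z₀ ∈ (Prod.fst ⁻¹' (extChartAt I p.1).target : Set (E × ℝ)) := by
    change z₀.1 ∈ (extChartAt I p.1).target
    rw [hz₀]
    exact mem_extChartAt_target p.1
  have hd : DifferentiableAt ℝ (localMetric (prodLineMetric g ε) p) z₀ := by
    suffices h : ContDiffOn ℝ ∞ (localMetric (prodLineMetric g ε) p)
        (Prod.fst ⁻¹' (extChartAt I p.1).target : Set (E × ℝ)) from
      (h.contDiffAt (hopen.mem_nhds hmem)).differentiableAt (by simp)
    rw [contDiffOn_clm_apply]
    intro a
    rw [contDiffOn_clm_apply]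
    intro b
    have h1 : ContDiffOn ℝ ∞ (fun z : E × ℝ ↦ localMetric g p.1 z.1 a.1 b.1 + ε * (a.2 * b.2))
        (Prod.fst ⁻¹' (extChartAt I p.1).target) :=
      ((((hg.contDiffOn_localMetric p.1).comp contDiffOn_fst fun z hz ↦ hz).clm_apply
        contDiffOn_const).clm_apply contDiffOn_const).add contDiffOn_const
    exact h1.congr fun z hz ↦ localMetric_prodLineMetric g ε p hz a b
  have key : ∀ a b c : E × ℝ, fderiv ℝ (localMetric (prodLineMetric g ε) p) z₀ a b c =
      fderiv ℝ (localMetric g p.1) (extChartAt I p.1 p.1) a.1 b.1 c.1 := by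
    intro a b c
    have hG : HasFDerivAt (localMetric g p.1) (fderiv ℝ (localMetric g p.1) z₀.1) z₀.1 := by
      rw [hz₀]
      exact ((hg.contDiffAt_localMetric p.1).differentiableAt (by simp)).hasFDerivAt
    have h1 := (hd.hasFDerivAt.clm_apply (hasFDerivAt_const b z₀)).clm_apply (hasFDerivAt_const c z₀)
    have hf : HasFDerivAt (Prod.fst : E × ℝ → E) (ContinuousLinearMap.fst ℝ E ℝ) z₀ :=
      hasFDerivAt_fst
    have hc : HasFDerivAt (fun z : E × ℝ ↦ localMetric g p.1 z.1)
        ((fderiv ℝ (localMetric g p.1) z₀.1).comp (ContinuousLinearMap.fst ℝ E ℝ)) z₀ :=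
      HasFDerivAt.comp (g := localMetric g p.1) (f := Prod.fst) z₀ hG hf
    have h2 := ((hc.clm_apply
      (hasFDerivAt_const b.1 z₀)).clm_apply (hasFDerivAt_const c.1 z₀)).add_const (ε * (b.2 * c.2))
    have h3 := h1.unique (h2.congr_of_eventuallyEq
      (Filter.mem_of_superset (hopen.mem_nhds hmem)
        fun z hz ↦ localMetric_prodLineMetric g ε p hz b c))
    rw [← hz₀]
    simpa using DFunLike.congr_fun h3 a
  simp only [christoffelLower, key]

theorem christoffelVector_prodLineMetric (hg : IsSemiRiemannianMetric g) {ε : ℝ} (hε : ε ≠ 0)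
    (p : M × ℝ) (v w : E × ℝ) :
    christoffelVector (prodLineMetric g ε) p v w = (christoffelVector g p.1 v.1 w.1, (0 : ℝ)) := by
  have hnd := prodLineMetric_form_nondegenerate hε (hg.form_nondegenerate p.1)
  refine eq_of_forall_apply_eq hnd fun z ↦ ?_
  have h1 := form_christoffel_apply hnd v w z
  rw [christoffelLower_prodLineMetric hg] at h1
  refine h1.trans ?_
  rw [prodLineMetric_form_apply, form_christoffel_apply (hg.form_nondegenerate p.1)]
  simp

end Product

section Graph

variable {E : Type*} [NormedAddCommGroup E] [NormedSpace ℝ E] [FiniteDimensional ℝ E]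
  {H : Type*} [TopologicalSpace H] {I : ModelWithCorners ℝ E H} [I.Boundaryless]
  {M : Type*} [TopologicalSpace M] [ChartedSpace H M] [IsManifold I ∞ M]
  {g : BilinField I M}

/-- The differential of the graph map of `u` at `x`, on the model spaces. -/
def graphDifferential (I : ModelWithCorners ℝ E H) (u : M → ℝ) (x : M) : E →L[ℝ] E × ℝ :=
  (ContinuousLinearMap.id ℝ E).prod (differential I u x)

omit [FiniteDimensional ℝ E] [I.Boundaryless] [IsManifold I ∞ M] in
theorem mfderiv_graphMap {u : M → ℝ} {x : M} (hu : MDifferentiableAt I 𝓘(ℝ, ℝ) u x) :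
    mfderiv I (I.prod 𝓘(ℝ, ℝ)) (graphMap u) x = graphDifferential I u x :=
  (mfderiv_prodMk mdifferentiableAt_id hu).trans (by rw [mfderiv_id]; rfl)

omit [FiniteDimensional ℝ E] [I.Boundaryless] [IsManifold I ∞ M] in
theorem pullbackMetric_graphMap (g : BilinField I M) (ε : ℝ) {u : M → ℝ} {x : M}
    (hu : MDifferentiableAt I 𝓘(ℝ, ℝ) u x) :
    (pullbackMetric (I := I) (prodLineMetric g ε) (graphMap u)).form x =
      ((prodLineMetric g ε).form (graphMap u x)).bilinearComp (graphDifferential I u x)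
        (graphDifferential I u x) := by
  let A : E →L[ℝ] E × ℝ := mfderiv I (I.prod 𝓘(ℝ, ℝ)) (graphMap u) x
  have hA : A = graphDifferential I u x := mfderiv_graphMap hu
  rw [← hA]
  rfl

omit [FiniteDimensional ℝ E] [I.Boundaryless] [IsManifold I ∞ M] in
theorem pullbackMetric_graphMap_apply (g : BilinField I M) (ε : ℝ) {u : M → ℝ} {x : M}
    (hu : MDifferentiableAt I 𝓘(ℝ, ℝ) u x) (v w : E) :
    (pullbackMetric (I := I) (prodLineMetric g ε) (graphMap u)).form x v w =
      g.form x v w + ε * (differential I u x v * differential I u x w) := by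
  rw [pullbackMetric_graphMap g ε hu]
  exact prodLineMetric_form_apply g ε _ _ _

omit [FiniteDimensional ℝ E] [I.Boundaryless] [IsManifold I ∞ M] in
theorem normalPart_graphMap (g : BilinField I M) (ε : ℝ) {u : M → ℝ} {x : M}
    (hu : MDifferentiableAt I 𝓘(ℝ, ℝ) u x) (ξ : E × ℝ) :
    normalPart I (prodLineMetric g ε) (graphMap u) x ξ =
      normalComponent ((prodLineMetric g ε).form (graphMap u x)) (graphDifferential I u x) ξ := by
  let A : E →L[ℝ] E × ℝ := mfderiv I (I.prod 𝓘(ℝ, ℝ)) (graphMap u) x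
  have hA : A = graphDifferential I u x := mfderiv_graphMap hu
  rw [← hA]
  rfl

omit [FiniteDimensional ℝ E] [I.Boundaryless] [IsManifold I ∞ M] in
theorem partialT_eq (p : M × ℝ) : partialT I p = ((0 : E), (1 : ℝ)) := by
  let A : ℝ →L[ℝ] E × ℝ := mfderiv 𝓘(ℝ, ℝ) (I.prod 𝓘(ℝ, ℝ)) (fun t : ℝ ↦ (p.1, t)) p.2
  have hA : A = (0 : ℝ →L[ℝ] E).prod (ContinuousLinearMap.id ℝ ℝ) :=
    (mfderiv_prodMk mdifferentiableAt_const mdifferentiableAt_id).trans (by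
      rw [mfderiv_id, mfderiv_const]; rfl)
  change A 1 = _
  rw [hA]
  rfl

omit [FiniteDimensional ℝ E] [IsManifold I ∞ M] in
theorem fderiv_fderiv_writtenInExtChartAt_graphMap {u : M → ℝ} {x : M}
    (hu : ContMDiffAt I 𝓘(ℝ, ℝ) 2 u x) (v w : E) :
    fderiv ℝ (fderiv ℝ (writtenInExtChartAt I (I.prod 𝓘(ℝ, ℝ)) x (graphMap u)))
      (extChartAt I x x) v w =
    ((0 : E), fderiv ℝ (fderiv ℝ (u ∘ (extChartAt I x).symm)) (extChartAt I x x) v w) := by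
  have h1 : writtenInExtChartAt I (I.prod 𝓘(ℝ, ℝ)) x (graphMap u) =ᶠ[nhds (extChartAt I x x)]
      fun y ↦ (y, (u ∘ (extChartAt I x).symm) y) := by
    filter_upwards [eventually_mem_extChartAt_target (I := I) x] with y hy
    change extChartAt (I.prod 𝓘(ℝ, ℝ)) (x, u x)
      ((extChartAt I x).symm y, u ((extChartAt I x).symm y)) = _
    rw [extChartAt_prod]
    exact Prod.ext ((extChartAt I x).right_inv hy) rfl
  have hu' := hu.contDiffAt_comp_extChartAt_symm
  have h2 : ∀ᶠ y in nhds (extChartAt I x x),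
      fderiv ℝ (fun y ↦ (y, (u ∘ (extChartAt I x).symm) y)) y w =
        (w, fderiv ℝ (u ∘ (extChartAt I x).symm) y w) := by
    filter_upwards [hu'.eventually (by decide)] with y hy
    exact DFunLike.congr_fun
      ((hasFDerivAt_id y).prodMk (hy.differentiableAt (by norm_num)).hasFDerivAt).fderiv w
  rw [h1.fderiv.fderiv_eq]
  have hD : HasFDerivAt (fderiv ℝ (u ∘ (extChartAt I x).symm)) _ (extChartAt I x x) :=
    ((hu'.fderiv_right (m := 1) (by norm_num)).differentiableAt (by norm_num)).hasFDerivAt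
  have hD' := (((contDiffAt_id.prodMk hu').fderiv_right (m := 1)
    (by norm_num)).differentiableAt (by norm_num)).hasFDerivAt.clm_apply (hasFDerivAt_const w _)
  have h4 := (hasFDerivAt_const w (extChartAt I x x)).prodMk
    (hD.clm_apply (hasFDerivAt_const w _))
  simpa using DFunLike.congr_fun (hD'.unique (h4.congr_of_eventuallyEq h2)) v

/-- The second fundamental form of a graph in `(M × ℝ, g + ε dt²)`. -/
theorem secondFundamentalForm_graphMap (hg : IsSemiRiemannianMetric g) {ε : ℝ} (hε : ε ≠ 0)
    {u : M → ℝ} (hu : ContMDiff I 𝓘(ℝ, ℝ) 2 u)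
    (hnd : (pullbackMetric (I := I) (prodLineMetric g ε) (graphMap u)).Nondegenerate)
    (x : M) (v w : E) :
    secondFundamentalForm I (prodLineMetric g ε) (graphMap u) x v w =
      hessian g u x v w • normalComponent ((prodLineMetric g ε).form (graphMap u x))
        (graphDifferential I u x) ((0 : E), (1 : ℝ)) := by
  have hux := hu.mdifferentiable (by simp) x
  have hnd' : ∀ v, (∀ w, ((prodLineMetric g ε).form (graphMap u x)).bilinearComp
      (graphDifferential I u x) (graphDifferential I u x) v w = 0) → v = 0 := by
    rw [← pullbackMetric_graphMap g ε hux]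
    exact hnd x
  let A : E →L[ℝ] E × ℝ := mfderiv I (I.prod 𝓘(ℝ, ℝ)) (graphMap u) x
  have hA : A = graphDifferential I u x := mfderiv_graphMap hux
  have h1 : secondFundamentalForm I (prodLineMetric g ε) (graphMap u) x v w =
      normalComponent ((prodLineMetric g ε).form (graphMap u x)) (graphDifferential I u x)
        (fderiv ℝ (fderiv ℝ (writtenInExtChartAt I (I.prod 𝓘(ℝ, ℝ)) x (graphMap u)))
          (extChartAt I x x) v w +
          christoffelVector (prodLineMetric g ε) (graphMap u x) (A v) (A w)) :=
    normalPart_graphMap g ε hux _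
  rw [h1, ← normalComponent_add_smul hnd' (christoffelVector g x v w), hA,
    christoffelVector_prodLineMetric hg hε, fderiv_fderiv_writtenInExtChartAt_graphMap (hu x)]
  congr 1
  have hd : differential I u x = fderiv ℝ (u ∘ (extChartAt I x).symm) (extChartAt I x x) :=
    mfderiv_eq_fderiv_comp_extChartAt_symm hux
  refine Prod.ext ?_ ?_
  · simp [graphDifferential, graphMap]
  · simp [graphDifferential, graphMap, hessian, hd]

/-- A graph in `(M × ℝ, g + ε dt²)` is a translating soliton if and only if the trace of the
Hessian of `u` with respect to the induced metric is `1`. -/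
theorem isTranslatingSoliton_graphMap_iff (hg : IsSemiRiemannianMetric g) {ε : ℝ} (hε : ε ≠ 0)
    {u : M → ℝ} (hu : ContMDiff I 𝓘(ℝ, ℝ) 2 u)
    (hnd : (pullbackMetric (I := I) (prodLineMetric g ε) (graphMap u)).Nondegenerate) :
    IsTranslatingSoliton I g ε (graphMap u) ↔ ∀ x,
      metricTrace ((pullbackMetric (I := I) (prodLineMetric g ε) (graphMap u)).form x)
        (hessian g u x) = 1 := by
  have hux := hu.mdifferentiable (by simp)
  have key : ∀ x, meanCurvatureVector I (prodLineMetric g ε) (graphMap u) x =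
      normalPart I (prodLineMetric g ε) (graphMap u) x (partialT I (graphMap u x)) ↔
      metricTrace ((pullbackMetric (I := I) (prodLineMetric g ε) (graphMap u)).form x)
        (hessian g u x) = 1 := by
    intro x
    set ν := normalComponent ((prodLineMetric g ε).form (graphMap u x))
        (graphDifferential I u x) ((0 : E), (1 : ℝ)) with hν_def
    have hν : ν ≠ 0 := by
      intro h0
      obtain ⟨a, ha⟩ := normalComponent_eq_zero h0
      have ha1 : a = 0 := congrArg Prod.fst ha
      have ha2 : differential I u x a = 1 := congrArg Prod.snd ha
      rw [ha1, map_zero] at ha2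
      exact zero_ne_one ha2
    have h1 : meanCurvatureVector I (prodLineMetric g ε) (graphMap u) x =
        metricTrace ((pullbackMetric (I := I) (prodLineMetric g ε) (graphMap u)).form x)
          (hessian g u x) • ν := by
      rw [← metricTrace_smul_const]
      have h2 : (fun v w : E ↦ secondFundamentalForm I (prodLineMetric g ε) (graphMap u) x v w) =
          fun v w : E ↦ hessian g u x v w • ν := by
        funext v w
        exact secondFundamentalForm_graphMap hg hε hu hnd x v w
      unfold meanCurvatureVector
      exact congrArg (metricTrace
        ((pullbackMetric (I := I) (prodLineMetric g ε) (graphMap u)).form x)) h2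
    have h3 : normalPart I (prodLineMetric g ε) (graphMap u) x (partialT I (graphMap u x)) = ν := by
      rw [partialT_eq]
      exact normalPart_graphMap g ε (hux x) _
    rw [h1, h3]
    constructor
    · intro h
      have h' : metricTrace ((pullbackMetric (I := I) (prodLineMetric g ε) (graphMap u)).form x)
          (hessian g u x) • ν = (1 : ℝ) • ν := h.trans (one_smul ℝ ν).symm
      exact smul_left_injective ℝ hν h'
    · intro h
      rw [h]
      exact one_smul ℝ ν
  refine ⟨fun h x ↦ (key x).1 (h.meanCurvature_eq x), fun h ↦ ⟨contMDiff_id.prodMk hu, hnd, fun x ↦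
    (key x).2 (h x)⟩⟩

end Graph

section InvariantGraph

/-- If `u = f ∘ p` with `p` a submersion to the line at `y`, then `f` is as smooth as `u`
and `p`. -/
theorem contDiffAt_of_comp_submersion {V : Type*} [NormedAddCommGroup V] [NormedSpace ℝ V]
    {n : WithTop ℕ∞} (hn : n ≠ 0) {p : V → ℝ} {f : ℝ → ℝ} {y v : V} (hp : ContDiffAt ℝ n p y)
    (hv : fderiv ℝ p y v = 1) (hfp : ContDiffAt ℝ n (f ∘ p) y) : ContDiffAt ℝ n f (p y) := by
  let c : ℝ → V := fun t ↦ y + t • v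
  have hc0 : c 0 = y := by simp [c]
  have hc : ContDiff ℝ n c := contDiff_const.add (contDiff_id.smul contDiff_const)
  have hq : ContDiffAt ℝ n (p ∘ c) 0 := ContDiffAt.comp 0 (by rwa [hc0]) hc.contDiffAt
  have hc' : HasDerivAt c v 0 := by
    have := ((hasDerivAt_id (0 : ℝ)).smul_const v).const_add y
    rwa [one_smul] at this
  have hq' : HasDerivAt (p ∘ c) 1 0 := by
    rw [← hv]
    exact HasFDerivAt.comp_hasDerivAt 0
      (by rw [hc0]; exact (hp.differentiableAt hn).hasFDerivAt) hc'
  have hq'' : HasFDerivAt (p ∘ c) ((ContinuousLinearEquiv.refl ℝ ℝ : ℝ ≃L[ℝ] ℝ) : ℝ →L[ℝ] ℝ) 0 := by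
    have h1 : ContinuousLinearMap.toSpanSingleton ℝ (1 : ℝ) =
        ((ContinuousLinearEquiv.refl ℝ ℝ : ℝ ≃L[ℝ] ℝ) : ℝ →L[ℝ] ℝ) := by
      ext
      simp
    exact h1 ▸ hq'.hasFDerivAt
  have hinv := hq.to_localInverse hq'' hn
  have h0 := hq.localInverse_apply_image hq'' hn
  have hright := (hq.hasStrictFDerivAt' hq'' hn).eventually_right_inverse
  have hpy : (p ∘ c) 0 = p y := by simp [hc0]
  rw [hpy] at hinv h0 hright
  have hcomp : ContDiffAt ℝ n ((f ∘ p) ∘ c ∘ hq.localInverse hq'' hn) (p y) := by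
    refine ContDiffAt.comp _ ?_ (hc.contDiffAt.comp _ hinv)
    rwa [Function.comp_apply, h0, hc0]
  refine hcomp.congr_of_eventuallyEq ?_
  filter_upwards [hright] with s hs
  exact congrArg f hs.symm

variable {E : Type*} [NormedAddCommGroup E] [NormedSpace ℝ E] [FiniteDimensional ℝ E]
  {H : Type*} [TopologicalSpace H] {I : ModelWithCorners ℝ E H} [I.Boundaryless]
  {M : Type*} [TopologicalSpace M] [ChartedSpace H M] [IsManifold I ∞ M]
  {g : BilinField I M}

omit [FiniteDimensional ℝ E] [I.Boundaryless] [IsManifold I ∞ M] in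
theorem differential_comp {π : M → ℝ} {f : ℝ → ℝ} {x : M}
    (hπ : MDifferentiableAt I 𝓘(ℝ, ℝ) π x) (hf : DifferentiableAt ℝ f (π x)) (v : E) :
    differential I (f ∘ π) x v = deriv f (π x) * differential I π x v := by
  have h := (HasMFDerivAt.comp x hf.hasFDerivAt.hasMFDerivAt hπ.hasMFDerivAt).mfderiv
  have h1 : differential I (f ∘ π) x v = fderiv ℝ f (π x) (differential I π x v) :=
    DFunLike.congr_fun h v
  rw [h1, fderiv_eq_smul_deriv, smul_eq_mul, mul_comm]

/-- The trace of the Hessian of `f ∘ π` with respect to the metric induced on the graph of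
`f ∘ π`. -/
theorem metricTrace_hessian_comp (hg : IsSemiRiemannianMetric g) {ε c : ℝ} (hc : c * c = 1)
    {π : M → ℝ} (hπ : IsSemiRiemannianSubmersion g (lineMetric c) π) {f : ℝ → ℝ} {x : M}
    (hf : ContDiffAt ℝ 2 f (π x))
    (hnd : (pullbackMetric (I := I) (prodLineMetric g ε) (graphMap (f ∘ π))).Nondegenerate) :
    c + ε * deriv f (π x) ^ 2 ≠ 0 ∧
    metricTrace ((pullbackMetric (I := I) (prodLineMetric g ε) (graphMap (f ∘ π))).form x)
        (hessian g (f ∘ π) x) =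
      deriv f (π x) * fiberMeanCurvature g π x +
        deriv (deriv f) (π x) / (c + ε * deriv f (π x) ^ 2) := by
  have hπ2 : ContMDiff I 𝓘(ℝ, ℝ) 2 π := hπ.contMDiff.of_le ENat.LEInfty.out
  have hπx : MDifferentiableAt I 𝓘(ℝ, ℝ) π x := hπ2.mdifferentiable (by simp) x
  have hfx : DifferentiableAt ℝ f (π x) := hf.differentiableAt (by simp)
  have hux : MDifferentiableAt I 𝓘(ℝ, ℝ) (f ∘ π) x :=
    hfx.mdifferentiableAt.comp x hπx
  set a := deriv f (π x)
  set b := deriv (deriv f) (π x)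
  set N := gradientVector g π x
  set d := differential I π x
  set S := hessianOperator hg π x
  set γ := (pullbackMetric (I := I) (prodLineMetric g ε) (graphMap (f ∘ π))).form x with hγ_def
  have hγ : ∀ v w, γ v w = g.form x v w + ε * (a * d v * (a * d w)) := fun v w ↦ by
    rw [hγ_def, pullbackMetric_graphMap_apply g ε hux, differential_comp hπx hfx,
      differential_comp hπx hfx]
  have hN : ∀ w, g.form x N w = d w := hg.form_metricGradient π x
  have hdN : d N = c := hπ.differential_gradientVector hg hc x
  have hdS : ∀ v, d (S v) = 0 := hπ.differential_hessianOperator hg hc x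
  have hγN : ∀ w, γ N w = c * (c + ε * a ^ 2) * d w := fun w ↦ by
    rw [hγ, hN, hdN]
    linear_combination (-d w) * hc
  have hne : c + ε * a ^ 2 ≠ 0 := by
    intro h0
    have hN0 : N = 0 := hnd x N fun w ↦ (hγN w).trans (by rw [h0]; ring)
    rw [hN0, map_zero] at hdN
    rw [← hdN] at hc
    simp at hc
  refine ⟨hne, ?_⟩
  rw [hπ.fiberMeanCurvature_eq_trace hg hc x]
  have hT := metricTrace_eq_trace (γ := γ) (B := hessian g (f ∘ π) x) (hnd x)
    (fun v w ↦ by rw [hγ, hγ, hg.form_symm x]; ring)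
    (a • S + (c * b / (c + ε * a ^ 2)) • d.toLinearMap.smulRight N) (fun v w ↦ by
      have hS : γ (S v) w = hessian g π x v w := by
        rw [hγ, hdS, form_hessianOperator hg hπ2]
        ring
      rw [hessian_comp hπ2 hf]
      change γ (a • S v + (c * b / (c + ε * a ^ 2)) • d v • N) w = _
      rw [map_add, map_smul, map_smul, map_smul]
      simp only [add_apply, smul_apply, smul_eq_mul]
      rw [hS, hγN]
      change a * hessian g π x v w + c * b / (c + ε * a ^ 2) *
        (d v * (c * (c + ε * a ^ 2) * d w)) = b * d v * d w + a * hessian g π x v w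
      linear_combination (d v * d w * c) * div_mul_cancel₀ (c * b) hne + (b * d v * d w) * hc)
  rw [hT, map_add, map_smul, map_smul, LinearMap.trace_smulRight]
  change a • LinearMap.trace ℝ E S + (c * b / (c + ε * a ^ 2)) • d N = _
  rw [hdN, smul_eq_mul, smul_eq_mul, div_mul_eq_mul_div,
    show c * b * c = b by linear_combination b * hc]

end InvariantGraph

end

theorem mainTheorem4
    {E : Type*} [NormedAddCommGroup E] [NormedSpace ℝ E] [FiniteDimensional ℝ E]
    {H : Type*} [TopologicalSpace H] (I : ModelWithCorners ℝ E H) [I.Boundaryless]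
    {M : Type*} [TopologicalSpace M] [ChartedSpace H M] [IsManifold I ∞ M] [ConnectedSpace M]
    {EG : Type*} [NormedAddCommGroup EG] [NormedSpace ℝ EG] [FiniteDimensional ℝ EG]
    {HG : Type*} [TopologicalSpace HG] (IG : ModelWithCorners ℝ EG HG) [IG.Boundaryless]
    {G : Type*} [TopologicalSpace G] [ChartedSpace HG G] [Group G] [LieGroup IG ∞ G]
    [MulAction G M] [ContMDiffSMul IG I ∞ G M]
    (g : BilinField I M) (hg : IsSemiRiemannianMetric g)
    (hiso : ∀ a : G, PreservesMetric g (fun x : M ↦ a • x))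
    (ε ε' : ℝ) (hε : ε = 1 ∨ ε = -1) (hε' : ε' = 1 ∨ ε' = -1)
    (J : Set ℝ) (hJ : IsOpen J) (hJc : J.OrdConnected)
    (π : M → ℝ) (hπJ : ∀ x : M, π x ∈ J)
    (hπ : IsSemiRiemannianSubmersion g (lineMetric ε') π)
    (hfib : ∀ s ∈ J, ∃ x : M, π ⁻¹' {s} = MulAction.orbit G x) :
    (∃ h : ℝ → ℝ, RepresentsFiberMeanCurvature g π h) ∧
    ∀ h : ℝ → ℝ, RepresentsFiberMeanCurvature g π h →
      ∀ u : M → ℝ, ContMDiff I 𝓘(ℝ, ℝ) 2 u →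
        (pullbackMetric (I := I) (prodLineMetric g ε) (graphMap u)).Nondegenerate →
        ((IsTranslatingSoliton I g ε (graphMap u) ∧ ∀ (a : G) (x : M), u (a • x) = u x) ↔
          ∃ f : ℝ → ℝ, ContDiffOn ℝ 2 f J ∧
            (∀ s ∈ J, deriv (deriv f) s = (ε' + ε * deriv f s ^ 2) * (1 - deriv f s * h s)) ∧
            ∀ x : M, u x = f (π x)) := by
  have hc : ε' * ε' = 1 := by rcases hε' with rfl | rfl <;> norm_num
  have hε0 : ε ≠ 0 := by rcases hε with rfl | rfl <;> norm_num
  have hπ2 : ContMDiff I 𝓘(ℝ, ℝ) 2 π := hπ.contMDiff.of_le ENat.LEInfty.out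
  have hinv : ∀ (a : G) (x : M), π (a • x) = π x := by
    intro a x
    obtain ⟨x₀, hx₀⟩ := hfib (π x) (hπJ x)
    have hx : x ∈ MulAction.orbit G x₀ := hx₀ ▸ rfl
    have hax : a • x ∈ π ⁻¹' {π x} := by
      rw [hx₀]
      exact MulAction.mem_orbit_of_mem_orbit a hx
    exact hax
  have horbit : ∀ x y : M, π x = π y → ∃ a : G, a • y = x := by
    intro x y hxy
    obtain ⟨x₀, hx₀⟩ := hfib (π y) (hπJ y)
    have hx : x ∈ MulAction.orbit G x₀ := hx₀ ▸ hxy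
    have hy : y ∈ MulAction.orbit G x₀ := hx₀ ▸ rfl
    rw [← MulAction.orbit_eq_iff.2 hy] at hx
    exact hx
  have hfactor : ∀ k : M → ℝ, (∀ (a : G) x, k (a • x) = k x) →
      ∃ f : ℝ → ℝ, ∀ x, k x = f (π x) := by
    intro k hk
    obtain ⟨f, hf⟩ := (Function.factorsThrough_iff (f := π) k).1 fun x y hxy ↦ by
      obtain ⟨a, rfl⟩ := horbit x y hxy
      exact hk a y
    exact ⟨f, congrFun hf⟩
  refine ⟨?_, ?_⟩
  · refine hfactor _ fun a x ↦ ?_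
    rw [hπ.fiberMeanCurvature_eq_trace hg hc, hπ.fiberMeanCurvature_eq_trace hg hc]
    exact trace_hessianOperator_isometry hg hπ2
      (ContMDiffSMul.contMDiff_const_smul (I := IG) a) (hiso a) (hinv a) x
  intro h hh u hu hnd
  rw [isTranslatingSoliton_graphMap_iff hg hε0 hu hnd]
  have key : ∀ f : ℝ → ℝ, u = f ∘ π → ∀ x, ContDiffAt ℝ 2 f (π x) →
      (metricTrace ((pullbackMetric (I := I) (prodLineMetric g ε) (graphMap u)).form x)
        (hessian g u x) = 1 ↔ deriv (deriv f) (π x) =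
          (ε' + ε * deriv f (π x) ^ 2) * (1 - deriv f (π x) * h (π x))) := by
    rintro f rfl x hf
    obtain ⟨hne, htr⟩ := metricTrace_hessian_comp hg hc hπ hf hnd
    rw [htr, hh x, ← eq_sub_iff_add_eq', div_eq_iff hne, mul_comm]
  constructor
  · rintro ⟨hsol, huinv⟩
    obtain ⟨f, hf⟩ := hfactor u huinv
    have huf : u = f ∘ π := funext hf
    have hfC : ∀ x, ContDiffAt ℝ 2 f (π x) := by
      intro x
      obtain ⟨v, hv⟩ := hπ.surjective x (1 : ℝ)
      have hv' : fderiv ℝ (π ∘ (extChartAt I x).symm) (extChartAt I x x) v = 1 := by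
        rw [← mfderiv_eq_fderiv_comp_extChartAt_symm (hπ2.mdifferentiable (by simp) x)]
        exact hv
      have := contDiffAt_of_comp_submersion (f := f) (by simp)
        (hπ2 x).contDiffAt_comp_extChartAt_symm hv' (by
          have := (hu x).contDiffAt_comp_extChartAt_symm
          rwa [huf] at this)
      simpa using this
    have hJπ : ∀ s ∈ J, ∃ x, π x = s := by
      intro s hs
      obtain ⟨x, hx⟩ := hfib s hs
      have : x ∈ π ⁻¹' {s} := hx ▸ MulAction.mem_orbit_self x
      exact ⟨x, this⟩
    refine ⟨f, fun s hs ↦ ?_, fun s hs ↦ ?_, hf⟩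
    · obtain ⟨x, rfl⟩ := hJπ s hs
      exact (hfC x).contDiffWithinAt
    · obtain ⟨x, rfl⟩ := hJπ s hs
      exact (key f huf x (hfC x)).1 (hsol x)
  · rintro ⟨f, hfC, hode, hf⟩
    refine ⟨fun x ↦ (key f (funext hf) x (hfC.contDiffAt (hJ.mem_nhds (hπJ x)))).2
      (hode _ (hπJ x)), fun a x ↦ ?_⟩
    rw [hf, hf, hinv]
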